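/- Let $n>1$. Regard $\mathbb{C}S_n$ as a superalgebra whose even (resp. odd) part is spanned by the even (resp. odd) permutations. A $\mathbb{C}S_n$-supermodule is a $\mathbb{C}S_n$-module $V=V_{\bar 0}\oplus V_{\bar 1}$ with $(\mathbb{C}S_n)_i V_j\subseteq V_{i+j}$; it is simple if it is nonzero and has no subsupermodules (graded submodules) other than $0$ and $V$, and a simple supermodule is of Type M if it is simple as an ordinary $\mathbb{C}S_n$-module, and of Type Q otherwise. A homogeneous isomorphism of supermodules is a bijective linear map $f$ which is even or odd and satisfies $f(av)=(-1)^{\bar a\bar f}a f(v)$ for homogeneous $a$. For $\lambda\vdash n$ let $S^\lambda$ be the Specht module and $\lambda'$ the conjugate partition. There exist linear maps $\phi^\lambda:S^\lambda\to S^{\lambda'}$ ($\lambda\vdash n$) such that $\phi^\lambda(\sigma v)=\operatorname{sgn}(\sigma)\,\sigma\phi^\lambda(v)$ for all $\sigma\in S_n$, $v\in S^\lambda$, and $\phi^{\lambda'}\circ\phi^\lambda=\mathrm{id}_{S^\lambda}$. Fix any such family. For $\lambda=\lambda'$ let $S^{\lambda^+}$ and $S^{\lambda^-}$ be the $+1$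 and $-1$ eigenspaces of $\phi^\lambda$ on $S^\lambda$. Let $\overline{\mathcal P}(n)$ be any set of representatives for the classes $\{\lambda,\lambda'\}$ of partitions of $n$. Then there are $\mathbb{C}S_n$-supermodules $W^\lambda$, $\lambda\in\overline{\mathcal P}(n)$, such that: 1. If $\lambda\neq\lambda'$, then $W^\lambda$ is a simple supermodule of Type Q, and there is an isomorphism $W^\lambda\cong S^\lambda\oplus S^{\lambda'}$ of ordinary $\mathbb{C}S_n$-modules under which $$W^\lambda_{\bar 0}=\{u+\phi^\lambda(u):u\in S^\lambda\},\qquad W^\lambda_{\bar 1}=\{u-\phi^\lambda(u):u\in S^\lambda\}.$$ This decomposition is canonical: the two summands are the only $\mathbb{C}S_n$-submodules of $W^\lambda$ isomorphic to $S^\lambda$ and to $S^{\lambda'}$, respectively. There is a unique linear map $J^\lambda:W^\lambda\to W^\lambda$ with $J^\lambda(u\pm\phi^\lambda(u))=u\mp\phi^\lambda(u)$ for $u\in S^\lambda$, and it is an odd involution (it reverses parity and $J^\lambda\circ J^\lambda=\mathrm{id}$). 2. If $\lambda=\lambda'$, then $W^\lambda$ is a simple supermodule of Type M, and there is an isomorphism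 $W^\lambda\cong S^\lambda$ of ordinary $\mathbb{C}S_n$-modules under which $W^\lambda_{\bar 0}=S^{\lambda^+}$ and $W^\lambda_{\bar 1}=S^{\lambda^-}$. 3. The set $\{W^\lambda:\lambda\in\overline{\mathcal P}(n)\}$ is a complete set of pairwise non-isomorphic simple $\mathbb{C}S_n$-supermodules up to homogeneous isomorphism: every simple $\mathbb{C}S_n$-supermodule is isomorphic to some $W^\lambda$ via an even or odd isomorphism, and for $\lambda\neq\mu$ in $\overline{\mathcal P}(n)$ there is no even or odd isomorphism between $W^\lambda$ and $W^\mu$. -/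

import Mathlib

universe u v w

noncomputable section


/-! ### Superalgebras and supermodules over `ℂ` -/

/-- A (left) supermodule over the superalgebra `A = 𝒜 0 ⊕ 𝒜 1`: an `A`-module `V = V₀ ⊕ V₁`
such that `𝒜 i • V j ⊆ V (i + j)`. -/
structure Supermodule {A : Type v} [Ring A] [Algebra ℂ A] (𝒜 : ZMod 2 → Submodule ℂ A)
    [GradedAlgebra 𝒜] where
  carrier : Type u
  [instAddCommGroup : AddCommGroup carrier]
  [instModuleC : Module ℂ carrier]
  [instModule : Module A carrier]
  [instIsScalarTower : IsScalarTower ℂ A carrier]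
  /-- `grade 0` is the even part and `grade 1` the odd part. -/
  grade : ZMod 2 → Submodule ℂ carrier
  isCompl : IsCompl (grade 0) (grade 1)
  smul_mem : ∀ (i j : ZMod 2) (a : A) (v : carrier),
    a ∈ 𝒜 i → v ∈ grade j → a • v ∈ grade (i + j)

namespace Supermodule

attribute [instance] instAddCommGroup instModuleC instModule instIsScalarTower

variable {A : Type v} [Ring A] [Algebra ℂ A] {𝒜 : ZMod 2 → Submodule ℂ A} [GradedAlgebra 𝒜]

/-- The `A`-submodule `N` is a subsupermodule, i.e. it contains the homogeneous components of
its elements. -/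
def IsSubsupermodule (V : Supermodule.{u} 𝒜) (N : Submodule A V.carrier) : Prop :=
  ∀ x ∈ V.grade 0, ∀ y ∈ V.grade 1, x + y ∈ N → x ∈ N ∧ y ∈ N

/-- `V` is nonzero and its only subsupermodules are `0` and `V`. -/
def IsSimple (V : Supermodule.{u} 𝒜) : Prop :=
  Nontrivial V.carrier ∧
    ∀ N : Submodule A V.carrier, V.IsSubsupermodule N → N = ⊥ ∨ N = ⊤

/-- A simple supermodule which is simple as an ordinary module. -/
def IsSimpleTypeM (V : Supermodule.{u} 𝒜) : Prop :=
  V.IsSimple ∧ IsSimpleModule A V.carrier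

/-- A simple supermodule which is not simple as an ordinary module. -/
def IsSimpleTypeQ (V : Supermodule.{u} 𝒜) : Prop :=
  V.IsSimple ∧ ¬ IsSimpleModule A V.carrier

/-- The linear map `f` is a supermodule homomorphism that is homogeneous of superdegree `p`:
`f (V i) ⊆ W (i + p)`, and `f (a • v) = (-1) ^ (deg a * p) a • f v` for homogeneous `a`. -/
def IsHomOfDegree {V : Supermodule.{u} 𝒜} {W : Supermodule.{w} 𝒜} (p : ZMod 2)
    (f : V.carrier →ₗ[ℂ] W.carrier) : Prop :=
  (∀ i, ∀ x ∈ V.grade i, f x ∈ W.grade (i + p)) ∧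
    ∀ i, ∀ a ∈ 𝒜 i, ∀ x, f (a • x) = (-1 : ℂ) ^ (i.val * p.val) • a • f x

/-- Isomorphism via a homogeneous (even or odd) supermodule isomorphism. -/
def HomogeneouslyIsomorphic (V : Supermodule.{u} 𝒜) (W : Supermodule.{w} 𝒜) : Prop :=
  ∃ (p : ZMod 2) (f : V.carrier →ₗ[ℂ] W.carrier),
    IsHomOfDegree p f ∧ Function.Bijective f

/-- An odd involution of the underlying superspace: `J (V i) ⊆ V (i + 1)` and `J ∘ J = id`. -/
def IsOddInvolution (V : Supermodule.{u} 𝒜) (J : V.carrier →ₗ[ℂ] V.carrier) : Prop :=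
  (∀ i, ∀ x ∈ V.grade i, J x ∈ V.grade (i + 1)) ∧ ∀ x, J (J x) = x

end Supermodule

/-! ### The group superalgebra of the symmetric group -/

/-- The group algebra `ℂ S_n`. -/
abbrev GroupAlgSn (n : ℕ) : Type := MonoidAlgebra ℂ (Equiv.Perm (Fin n))

/-- The parity of a permutation. -/
def permParity {n : ℕ} (σ : Equiv.Perm (Fin n)) : ZMod 2 :=
  if Equiv.Perm.sign σ = 1 then 0 else 1

theorem permParity_mul {n : ℕ} (σ τ : Equiv.Perm (Fin n)) :
    permParity (σ * τ) = permParity σ + permParity τ := by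
  rcases Int.units_eq_one_or (Equiv.Perm.sign σ) with h | h <;>
    rcases Int.units_eq_one_or (Equiv.Perm.sign τ) with h' | h' <;>
    simp [permParity, h, h']; decide

/-- The `ℤ/2`-grading on `ℂ S_n`: degree `0` is the span of the even permutations, degree `1` the
span of the odd ones. -/
def snGrading (n : ℕ) (i : ZMod 2) : Submodule ℂ (GroupAlgSn n) :=
  Submodule.span ℂ (MonoidAlgebra.of ℂ (Equiv.Perm (Fin n)) '' {σ | permParity σ = i})

theorem snGrading_coeff {n : ℕ} {i : ZMod 2} {x : GroupAlgSn n} (hx : x ∈ snGrading n i)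
    {σ : Equiv.Perm (Fin n)} (hσ : permParity σ ≠ i) : x.coeff σ = 0 := by
  induction hx using Submodule.span_induction with
  | mem x h =>
    obtain ⟨τ, hτ, rfl⟩ := h
    have : τ ≠ σ := by rintro rfl; exact hσ hτ
    simp [MonoidAlgebra.of_apply, this]
  | zero => simp
  | add x y _ _ hx hy => simp [hx, hy]
  | smul c x _ hx => simp [hx]

theorem snGrading_isCompl (n : ℕ) : IsCompl (snGrading n 0) (snGrading n 1) := by
  constructor
  · rw [Submodule.disjoint_def]
    intro x h0 h1
    ext σ
    by_cases h : permParity σ = 0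
    · exact snGrading_coeff h1 (by rw [h]; decide)
    · exact snGrading_coeff h0 h
  · rw [codisjoint_iff, eq_top_iff]
    intro x _
    induction x using MonoidAlgebra.induction_on with
    | of σ =>
      by_cases h : permParity σ = 0
      · exact Submodule.mem_sup_left (Submodule.subset_span ⟨σ, h, rfl⟩)
      · refine Submodule.mem_sup_right (Submodule.subset_span ⟨σ, ?_, rfl⟩)
        unfold permParity at h ⊢
        split_ifs at h ⊢ <;> simp_all
    | add x y hx hy => exact Submodule.add_mem _ (hx trivial) (hy trivial)
    | smul c x hx => exact Submodule.smul_mem _ c (hx trivial)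

instance snGradedAlgebra (n : ℕ) : GradedAlgebra (snGrading n) where
  one_mem := Submodule.subset_span ⟨1, by simp [permParity], map_one _⟩
  mul_mem := by
    intro i j a b ha hb
    have h := Submodule.mul_mem_mul ha hb
    rw [snGrading, snGrading, Submodule.span_mul_span] at h
    refine Submodule.span_mono ?_ h
    rintro _ ⟨_, ⟨σ, hσ, rfl⟩, _, ⟨τ, hτ, rfl⟩, rfl⟩
    refine ⟨σ * τ, ?_, map_mul _ _ _⟩
    rw [Set.mem_ofPred_eq] at hσ hτ ⊢
    rw [permParity_mul, hσ, hτ]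
  toDecomposition := ((DirectSum.isInternal_submodule_iff_isCompl (snGrading n)
    (i := 0) (j := 1) (by decide) (Set.ext fun i => by simpa using (by decide : ∀ i : ZMod 2, i = 0 ∨ i = 1) i)).2
      (snGrading_isCompl n)).chooseDecomposition

/-! ### Partitions and Specht modules -/

/-- Partitions of `n`, as Young diagrams with `n` cells; the cell `(i, j)` is in row `i` and
column `j`. -/
abbrev Ptn (n : ℕ) : Type := {μ : YoungDiagram // μ.card = n}

/-- The conjugate (transpose) partition. -/
def Ptn.conj {n : ℕ} (μ : Ptn n) : Ptn n :=
  ⟨μ.1.transpose, by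
    refine Eq.trans ?_ μ.2
    exact Finset.card_bij (fun c _ => c.swap)
      (fun c hc => by simpa [YoungDiagram.mem_transpose] using hc)
      (fun a _ b _ h => Prod.swap_injective h)
      (fun b hb => ⟨b.swap, by simpa [YoungDiagram.mem_transpose] using hb, by simp⟩)⟩

/-- `R` is a set of representatives for the classes `{μ, μ'}` of partitions of `n`. -/
def IsConjRepresentatives {n : ℕ} (R : Set (Ptn n)) : Prop :=
  ∀ μ : Ptn n, ∃! ν, ν ∈ R ∧ (ν = μ ∨ ν = μ.conj)

/-- Functions assigning a row index to each of the letters. A tabloid (a tableau up to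
permutations within its rows) is the same thing as the assignment of a row to each letter. -/
def RowAssignment (n : ℕ) : Type := Fin n → ℕ

/-- Permutations act by permuting the letters: `σ k` lies in the row in which `k` was. -/
instance (n : ℕ) : MulAction (Equiv.Perm (Fin n)) (RowAssignment n) where
  smul σ f := fun k => f (σ⁻¹ k)
  one_smul _ := rfl
  mul_smul σ τ f := by
    funext k
    change f ((σ * τ)⁻¹ k) = f (τ⁻¹ (σ⁻¹ k))
    rw [mul_inv_rev]
    rfl

/-- The permutation module on all row assignments. It contains, for each partition `μ` of `n`, the
permutation module `M^μ` spanned by the tabloids of shape `μ`. -/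
abbrev TabloidModule (n : ℕ) : Type :=
  (Representation.ofMulAction ℂ (Equiv.Perm (Fin n)) (RowAssignment n)).asModule

/-- A tableau of shape `μ`: a bijection sending each letter to the cell that it occupies. -/
abbrev Tableau {n : ℕ} (μ : Ptn n) : Type := Fin n ≃ μ.1.cells

/-- The tabloid of a tableau, as an element of the permutation module. -/
def Tableau.tabloid {n : ℕ} {μ : Ptn n} (T : Tableau μ) : TabloidModule n :=
  (Representation.asModuleEquiv _).symm
    (MonoidAlgebra.single (show RowAssignment n from fun k => (T k).1.1) (1 : ℂ))

/-- The signed sum `∑ sgn(π) π` over the column stabilizer of a tableau. -/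
def Tableau.columnAntisymmetrizer {n : ℕ} {μ : Ptn n} (T : Tableau μ) : GroupAlgSn n :=
  ∑ π : Equiv.Perm (Fin n) with ∀ k, (T (π k)).1.2 = (T k).1.2,
    MonoidAlgebra.single π ((Equiv.Perm.sign π : ℤ) : ℂ)

/-- The polytabloid of a tableau. -/
def Tableau.polytabloid {n : ℕ} {μ : Ptn n} (T : Tableau μ) : TabloidModule n :=
  T.columnAntisymmetrizer • T.tabloid

/-- The Specht module `S^μ`: the submodule generated by the polytabloids of shape `μ`. -/
def specht {n : ℕ} (μ : Ptn n) : Submodule (GroupAlgSn n) (TabloidModule n) :=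
  Submodule.span (GroupAlgSn n) (Set.range (Tableau.polytabloid (μ := μ)))

/-- A choice of maps `φ^μ : S^μ → S^{μ'}` with `φ^μ (σ v) = sgn(σ) σ φ^μ(v)` and
`φ^{μ'} ∘ φ^μ = id`. The last equation is read in the common ambient module, since `S^{μ''}` and
`S^μ` are the same submodule of it. -/
def IsAssociatorFamily {n : ℕ} (φ : ∀ μ : Ptn n, specht μ →ₗ[ℂ] specht μ.conj) : Prop :=
  (∀ (μ : Ptn n) (σ : Equiv.Perm (Fin n)) (x : specht μ),
    φ μ (MonoidAlgebra.of ℂ _ σ • x) =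
      ((Equiv.Perm.sign σ : ℤ) : ℂ) • MonoidAlgebra.of ℂ _ σ • φ μ x) ∧
  ∀ (μ : Ptn n) (x : specht μ),
    ((φ μ.conj (φ μ x) : specht μ.conj.conj) : TabloidModule n) = (x : TabloidModule n)

/-- The eigenspace `{x ∈ S^μ | f x = ε x}` of a map `f : S^μ → S^{μ'}`, used for `μ = μ'`; for
`f = φ^μ` and `ε = 1, -1` these are `S^{μ+}` and `S^{μ-}`. -/
def spechtEigen {n : ℕ} {μ : Ptn n} (f : specht μ →ₗ[ℂ] specht μ.conj) (ε : ℂ) :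
    Submodule ℂ (specht μ) where
  carrier := {x | (f x : TabloidModule n) = ε • (x : TabloidModule n)}
  add_mem' {x y} hx hy := by
    simp only [Set.mem_ofPred_eq] at hx hy ⊢
    simp [hx, hy]
  zero_mem' := by simp
  smul_mem' c x hx := by
    simp only [Set.mem_ofPred_eq] at hx ⊢
    simp [hx, smul_comm c ε]

end

/-! A supermodule over a superalgebra is a module `V` with an involution that is semilinear with
respect to the parity automorphism. A map `φ` that commutes with permutations up to sign is likewise
parity-semilinear, so the associators turn `S^μ ⊕ S^{μ'}`, through the exchange
`(x, y) ↦ (φ⁻¹ y, φ x)`, and a self-conjugate `S^μ`, through `φ` itself, into supermodules; in the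
other direction, the parity operator of a simple supermodule extends an embedding of `S^μ` to a map
from one of these.

The Specht modules are simple and pairwise non-isomorphic by James's argument: the column
antisymmetrizer of a tableau of shape `μ` maps `S^μ` onto the line of its polytabloid and kills
`S^ν` unless `μ` dominates `ν`. There are as many of them as conjugacy classes, so orthogonality of
characters shows that they are all the simple modules. An associator sends the tabloid of `T` to the
polytabloid of the transposed tableau; by Schur's lemma the composite `S^μ → S^{μ'} → S^μ` is a
scalar, the same one for `μ` and `μ'`, and dividing by a square root of it normalizes the family. -/

noncomputable section

open Equiv (Perm)

set_option maxSynthPendingDepth 3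

/-! ### Supermodules and the parity operator -/

theorem neg_one_pow_val_add (i j : ZMod 2) :
    (-1 : ℂ) ^ (i + j).val = (-1) ^ i.val * (-1) ^ j.val := by
  rw [ZMod.val_add, ← pow_add, ← neg_one_pow_eq_pow_mod_two]

theorem zmod_two_eq_zero_or_one : ∀ i : ZMod 2, i = 0 ∨ i = 1 := by
  decide

section ParityAutomorphism

variable {A : Type v} [Ring A] [Algebra ℂ A] (𝒜 : ZMod 2 → Submodule ℂ A) [GradedAlgebra 𝒜]

/-- The parity automorphism of a superalgebra, `a ↦ (-1)^i a` on `𝒜 i`. The maps `f` with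
`f (a • x) = (-1)^i a • f x` for `a ∈ 𝒜 i` are the maps that are semilinear with respect to it. -/
def parityAut : A →+* A :=
  ((DirectSum.toAlgebra ℂ (fun i => 𝒜 i) (fun i => (-1 : ℂ) ^ i.val • (𝒜 i).subtype)
    (by simp)
    (fun {i j} a b => by
      simp [neg_one_pow_val_add, smul_smul, mul_comm])).comp
    (DirectSum.decomposeAlgEquiv 𝒜).toAlgHom).toRingHom

variable {𝒜}

theorem parityAut_of_mem {i : ZMod 2} {a : A} (ha : a ∈ 𝒜 i) :
    parityAut 𝒜 a = (-1 : ℂ) ^ i.val • a := by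
  simp only [parityAut, AlgHom.toRingHom_eq_coe, RingHom.coe_coe, AlgHom.comp_apply,
    AlgEquiv.coe_toAlgHom, DirectSum.decomposeAlgEquiv_apply,
    DirectSum.decompose_of_mem 𝒜 ha]
  exact DirectSum.toAddMonoid_of
    (fun j => ((-1 : ℂ) ^ j.val • (𝒜 j).subtype).toAddMonoidHom) i ⟨a, ha⟩

@[simp]
theorem parityAut_algebraMap (c : ℂ) : parityAut 𝒜 (algebraMap ℂ A c) = algebraMap ℂ A c := by
  simp [parityAut]

theorem parityAut_involutive : Function.Involutive (parityAut 𝒜) := by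
  intro a
  induction a using DirectSum.Decomposition.inductionOn 𝒜 with
  | zero => simp
  | @homogeneous i a =>
    have h := Submodule.smul_mem _ ((-1 : ℂ) ^ i.val) a.2
    rw [parityAut_of_mem a.2, parityAut_of_mem h, smul_smul, ← mul_pow, neg_one_mul, neg_neg,
      one_pow, one_smul]
  | add a b ha hb => simp [ha, hb]

instance : RingHomInvPair (parityAut 𝒜) (parityAut 𝒜) where
  comp_eq := RingHom.ext parityAut_involutive
  comp_eq₂ := RingHom.ext parityAut_involutive

variable {V W : Type*} [AddCommGroup V] [Module ℂ V] [Module A V]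
  [AddCommGroup W] [Module ℂ W] [Module A W]

/-- A parity-semilinear map, as a `ℂ`-linear map. -/
def complexLinear [IsScalarTower ℂ A V] [IsScalarTower ℂ A W]
    (f : V →ₛₗ[parityAut 𝒜] W) : V →ₗ[ℂ] W where
  toFun := f
  map_add' := map_add f
  map_smul' c x := by
    rw [← algebraMap_smul A c x, map_smulₛₗ, parityAut_algebraMap, algebraMap_smul,
      RingHom.id_apply]

@[simp]
theorem complexLinear_apply [IsScalarTower ℂ A V] [IsScalarTower ℂ A W]
    (f : V →ₛₗ[parityAut 𝒜] W) (x : V) : complexLinear f x = f x := rfl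

variable (𝒜) in
/-- A `ℂ`-linear map that is semilinear for the homogeneous elements of `A`, as a semilinear
map. -/
def semilinearOfHomogeneous (σ : A →+* A) (f : V →ₗ[ℂ] W)
    (hf : ∀ i, ∀ a ∈ 𝒜 i, ∀ x, f (a • x) = σ a • f x) : V →ₛₗ[σ] W where
  toFun := f
  map_add' := map_add f
  map_smul' a x := by
    induction a using DirectSum.Decomposition.inductionOn 𝒜 with
    | zero => simp
    | @homogeneous i a => exact hf i a a.2 x
    | add a b ha hb => simp only [add_smul, map_add, ha, hb]

end ParityAutomorphism

namespace Supermodule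

variable {A : Type v} [Ring A] [Algebra ℂ A] {𝒜 : ZMod 2 → Submodule ℂ A} [GradedAlgebra 𝒜]

section Parity

variable (V : Supermodule.{u} 𝒜)

theorem exists_homogeneous_add (x : V.carrier) : ∃ a ∈ V.grade 0, ∃ b ∈ V.grade 1, a + b = x :=
  Submodule.mem_sup.1 (V.isCompl.sup_eq_top ▸ Submodule.mem_top)

/-- The parity operator of a supermodule as a `ℂ`-linear map; see `Supermodule.parity`. -/
def complexParity : V.carrier →ₗ[ℂ] V.carrier :=
  LinearMap.ofIsCompl V.isCompl (V.grade 0).subtype (-(V.grade 1).subtype)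

theorem complexParity_of_mem {i : ZMod 2} {x : V.carrier} (hx : x ∈ V.grade i) :
    V.complexParity x = (-1 : ℂ) ^ i.val • x := by
  rcases zmod_two_eq_zero_or_one i with rfl | rfl
  · rw [ZMod.val_zero, pow_zero, one_smul]
    exact LinearMap.ofIsCompl_apply_left V.isCompl ⟨x, hx⟩
  · rw [ZMod.val_one, pow_one, neg_one_smul]
    exact LinearMap.ofIsCompl_apply_right V.isCompl ⟨x, hx⟩

theorem complexParity_smul (i : ZMod 2) (a : A) (ha : a ∈ 𝒜 i) (x : V.carrier) :
    V.complexParity (a • x) = parityAut 𝒜 a • V.complexParity x := by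
  have homogeneous (j : ZMod 2) (y : V.carrier) (hy : y ∈ V.grade j) :
      V.complexParity (a • y) = parityAut 𝒜 a • V.complexParity y := by
    rw [V.complexParity_of_mem hy, V.complexParity_of_mem (V.smul_mem i j a y ha hy),
      parityAut_of_mem ha, neg_one_pow_val_add, smul_assoc, smul_comm a, smul_smul]
  obtain ⟨y, hy, z, hz, rfl⟩ := V.exists_homogeneous_add x
  simp only [smul_add, map_add, homogeneous 0 y hy, homogeneous 1 z hz]

/-- The parity operator of a supermodule: the identity on the even part and minus the identity on
the odd part. -/
def parity : V.carrier →ₛₗ[parityAut 𝒜] V.carrier :=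
  semilinearOfHomogeneous 𝒜 (parityAut 𝒜) V.complexParity V.complexParity_smul

theorem parity_of_mem {i : ZMod 2} {x : V.carrier} (hx : x ∈ V.grade i) :
    V.parity x = (-1 : ℂ) ^ i.val • x :=
  V.complexParity_of_mem hx

theorem parity_add_of_mem {x y : V.carrier} (hx : x ∈ V.grade 0) (hy : y ∈ V.grade 1) :
    V.parity (x + y) = x - y := by
  simp [V.parity_of_mem hx, V.parity_of_mem hy, ZMod.val_one, sub_eq_add_neg]

theorem parity_involutive : Function.Involutive V.parity := by
  intro x
  obtain ⟨y, hy, z, hz, rfl⟩ := V.exists_homogeneous_add x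
  rw [V.parity_add_of_mem hy hz, sub_eq_add_neg, V.parity_add_of_mem hy (neg_mem hz),
    sub_neg_eq_add]

theorem mem_grade_iff {i : ZMod 2} {x : V.carrier} :
    x ∈ V.grade i ↔ V.parity x = (-1 : ℂ) ^ i.val • x := by
  refine ⟨V.parity_of_mem, fun h => ?_⟩
  obtain ⟨y, hy, z, hz, rfl⟩ := V.exists_homogeneous_add x
  rw [V.parity_add_of_mem hy hz] at h
  have : IsAddTorsionFree V.carrier := .of_isTorsionFree ℂ _
  rcases zmod_two_eq_zero_or_one i with rfl | rfl
  · rw [ZMod.val_zero, pow_zero, one_smul, sub_eq_add_neg, add_right_inj, neg_eq_self] at h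
    rwa [h, add_zero]
  · rw [ZMod.val_one, pow_one, neg_one_smul, neg_add, sub_eq_add_neg, add_left_inj, self_eq_neg]
      at h
    rwa [h, zero_add]

theorem isSubsupermodule_iff (N : Submodule A V.carrier) :
    V.IsSubsupermodule N ↔ ∀ x ∈ N, V.parity x ∈ N := by
  constructor
  · intro h x hx
    obtain ⟨y, hy, z, hz, rfl⟩ := V.exists_homogeneous_add x
    rw [V.parity_add_of_mem hy hz]
    exact N.sub_mem (h y hy z hz hx).1 (h y hy z hz hx).2
  · intro h y hy z hz hyz
    have hsub := h _ hyz
    rw [V.parity_add_of_mem hy hz] at hsub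
    have hyN : y ∈ N := by
      have : (2⁻¹ : ℂ) • ((y + z) + (y - z)) ∈ N :=
        (N.restrictScalars ℂ).smul_mem _ (N.add_mem hyz hsub)
      rwa [add_add_sub_cancel, ← two_smul ℂ y, inv_smul_smul₀ two_ne_zero] at this
    exact ⟨hyN, (N.add_mem_iff_right hyN).1 hyz⟩

end Parity

section OfInvolution

variable {V : Type u} [AddCommGroup V] [Module ℂ V] [Module A V] [IsScalarTower ℂ A V]

/-- The supermodule structure on `V` whose even and odd parts are the eigenspaces of a
parity-semilinear involution. -/
abbrev ofInvolution (δ : V →ₛₗ[parityAut 𝒜] V) (hδ : Function.Involutive δ) :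
    Supermodule.{u} 𝒜 where
  carrier := V
  grade i := LinearMap.eqLocus (complexLinear δ) ((-1 : ℂ) ^ i.val • LinearMap.id)
  isCompl := by
    refine isCompl_iff.2 ⟨Submodule.disjoint_def.2 fun x h0 h1 => ?_,
      codisjoint_iff.2 (eq_top_iff.2 fun x _ => Submodule.mem_sup.2
        ⟨(2⁻¹ : ℂ) • (x + δ x), ?_, (2⁻¹ : ℂ) • (x - δ x), ?_, ?_⟩)⟩
    · have : IsAddTorsionFree V := .of_isTorsionFree ℂ _
      simp only [LinearMap.mem_eqLocus, complexLinear_apply, ZMod.val_zero, ZMod.val_one, pow_zero,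
        pow_one, neg_smul, one_smul, LinearMap.neg_apply, LinearMap.id_apply] at h0 h1
      exact self_eq_neg.1 (h0.symm.trans h1)
    · simp only [LinearMap.mem_eqLocus, map_smul, map_add, complexLinear_apply, hδ x,
        ZMod.val_zero, pow_zero, one_smul, LinearMap.id_apply, add_comm]
    · simp only [LinearMap.mem_eqLocus, map_smul, map_sub, complexLinear_apply, hδ x,
        ZMod.val_one, pow_one, neg_smul, one_smul, LinearMap.neg_apply, LinearMap.id_apply]
      congr 1
      abel
    · rw [← smul_add, add_add_sub_cancel, ← two_smul ℂ x, inv_smul_smul₀ two_ne_zero]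
  smul_mem i j a x ha hx := by
    simp only [LinearMap.mem_eqLocus, complexLinear_apply, LinearMap.smul_apply,
      LinearMap.id_apply] at hx ⊢
    rw [map_smulₛₗ, hx, parityAut_of_mem ha, neg_one_pow_val_add, smul_assoc, smul_comm a,
      smul_smul]

variable (δ : V →ₛₗ[parityAut 𝒜] V) (hδ : Function.Involutive δ)

theorem mem_grade_ofInvolution {i : ZMod 2} {x : V} :
    x ∈ (ofInvolution δ hδ).grade i ↔ δ x = (-1 : ℂ) ^ i.val • x := Iff.rfl

theorem parity_ofInvolution (x : V) : (ofInvolution δ hδ).parity x = δ x := by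
  obtain ⟨y, hy, z, hz, rfl⟩ := (ofInvolution δ hδ).exists_homogeneous_add x
  have hδy : δ y = y := by simpa using (mem_grade_ofInvolution δ hδ).1 hy
  have hδz : δ z = -z := by simpa [ZMod.val_one] using (mem_grade_ofInvolution δ hδ).1 hz
  rw [parity_add_of_mem _ hy hz, map_add, hδy, hδz, sub_eq_add_neg]

end OfInvolution

section HomogeneousIsomorphism

variable {V : Supermodule.{u} 𝒜} {W : Supermodule.{w} 𝒜}

theorem HomogeneouslyIsomorphic.nonempty_linearEquiv (h : V.HomogeneouslyIsomorphic W) :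
    Nonempty (V.carrier ≃ₗ[A] W.carrier) := by
  obtain ⟨p, f, ⟨-, hf⟩, hbij⟩ := h
  rcases zmod_two_eq_zero_or_one p with rfl | rfl
  · exact ⟨LinearEquiv.ofBijective
      (semilinearOfHomogeneous 𝒜 (RingHom.id A) f fun i a ha x => by simpa using hf i a ha x) hbij⟩
  · let g := semilinearOfHomogeneous 𝒜 (parityAut 𝒜) f fun i a ha x => by
      simpa [parityAut_of_mem ha, ZMod.val_one] using hf i a ha x
    exact ⟨LinearEquiv.ofBijective (W.parity.comp g : V.carrier →ₗ[A] W.carrier)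
      (W.parity_involutive.bijective.comp hbij)⟩

theorem homogeneouslyIsomorphic_of_bijective (p : ZMod 2) (g : W.carrier →ₗ[A] V.carrier)
    (hg : Function.Bijective g)
    (hparity : ∀ x, V.parity (g x) = (-1 : ℂ) ^ p.val • g (W.parity x)) :
    V.HomogeneouslyIsomorphic W := by
  let e := LinearEquiv.ofBijective g hg
  have hge (x : V.carrier) : g (e.symm x) = x := e.apply_symm_apply x
  have hgrade (i : ZMod 2) (x : V.carrier) (hx : x ∈ V.grade i) : e.symm x ∈ W.grade (i + p) := by
    have h := hparity (e.symm x)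
    rw [hge, V.parity_of_mem hx, eq_comm, ← eq_inv_smul_iff₀ (by simp)] at h
    rw [mem_grade_iff]
    apply hg.injective
    rw [h, g.map_smul_of_tower, hge, neg_one_pow_val_add, smul_smul, ← inv_pow, inv_neg_one,
      mul_comm]
  rcases zmod_two_eq_zero_or_one p with rfl | rfl
  · refine ⟨0, e.symm.toLinearMap.restrictScalars ℂ, ⟨hgrade, fun i a _ x => ?_⟩, e.symm.bijective⟩
    simp
  · refine ⟨1, complexLinear (W.parity.comp e.symm.toLinearMap), ⟨fun i x hx => ?_,
      fun i a ha x => ?_⟩, W.parity_involutive.bijective.comp e.symm.bijective⟩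
    · have h := hgrade i x hx
      simpa [W.parity_of_mem h] using Submodule.smul_mem _ _ h
    · simp [parityAut_of_mem ha, ZMod.val_one]

/-- Schur's lemma for simple supermodules: the kernel and the range of `g` are subsupermodules. -/
theorem IsSimple.homogeneouslyIsomorphic (hV : V.IsSimple) (hW : W.IsSimple) (p : ZMod 2)
    (g : W.carrier →ₗ[A] V.carrier) (hg : g ≠ 0)
    (hparity : ∀ x, V.parity (g x) = (-1 : ℂ) ^ p.val • g (W.parity x)) :
    V.HomogeneouslyIsomorphic W := by
  have hker : LinearMap.ker g = ⊥ := by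
    refine (hW.2 _ ((W.isSubsupermodule_iff _).2 fun x hx => ?_)).resolve_right
      (mt LinearMap.ker_eq_top.1 hg)
    have h := hparity x
    rw [LinearMap.mem_ker.1 hx, map_zero, eq_comm] at h
    exact (smul_eq_zero.1 h).resolve_left (by simp)
  have hrange : LinearMap.range g = ⊤ := by
    refine (hV.2 _ ((V.isSubsupermodule_iff _).2 ?_)).resolve_left (mt LinearMap.range_eq_bot.1 hg)
    rintro _ ⟨x, rfl⟩
    exact ⟨(-1 : ℂ) ^ p.val • W.parity x, by rw [hparity, g.map_smul_of_tower]⟩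
  exact homogeneouslyIsomorphic_of_bijective p g
    ⟨LinearMap.ker_eq_bot.1 hker, LinearMap.range_eq_top.1 hrange⟩ hparity

end HomogeneousIsomorphism

end Supermodule

section SimpleProduct

variable {A : Type*} [Ring A] {S S' : Type*} [AddCommGroup S] [Module A S] [AddCommGroup S']
  [Module A S'] [IsSimpleModule A S] [IsSimpleModule A S']

theorem isSemisimpleModule_prod : IsSemisimpleModule A (S × S') := by
  have : IsSimpleModule A (Submodule.fst A S S') := .congr (Submodule.fstEquiv A S S')
  have : IsSimpleModule A (Submodule.snd A S S') := .congr (Submodule.sndEquiv A S S')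
  have h := IsSemisimpleModule.sup (p := Submodule.fst A S S') (q := Submodule.snd A S S')
    inferInstance inferInstance
  rw [Submodule.fst_sup_snd] at h
  exact .congr Submodule.topEquiv.symm

theorem not_isSimpleModule_prod : ¬ IsSimpleModule A (S × S') := by
  intro h
  have := IsSimpleModule.nontrivial A S
  have := IsSimpleModule.nontrivial A S'
  obtain ⟨x, hx⟩ := exists_ne (0 : S)
  obtain ⟨y, hy⟩ := exists_ne (0 : S')
  have hinj := (LinearMap.fst A S S').injective_of_ne_zero fun h =>
    hx (LinearMap.congr_fun h (x, 0))
  exact hy (congrArg Prod.snd (@hinj (0, y) 0 rfl))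

theorem nonempty_linearEquiv_of_hom_prod {M : Type*} [AddCommGroup M] [Module A M]
    [IsSimpleModule A M] {f : M →ₗ[A] S × S'} (hf : f ≠ 0) :
    Nonempty (M ≃ₗ[A] S) ∨ Nonempty (M ≃ₗ[A] S') := by
  by_contra! h
  have hfst := ((LinearMap.fst A S S').comp f).bijective_or_eq_zero.resolve_left
    fun h' => h.1.elim (LinearEquiv.ofBijective _ h')
  have hsnd := ((LinearMap.snd A S S').comp f).bijective_or_eq_zero.resolve_left
    fun h' => h.2.elim (LinearEquiv.ofBijective _ h')
  exact hf (LinearMap.ext fun x =>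
    Prod.ext (LinearMap.congr_fun hfst x) (LinearMap.congr_fun hsnd x))

theorem eq_fst_or_eq_snd_of_isSimpleModule (hne : IsEmpty (S ≃ₗ[A] S')) (N : Submodule A (S × S'))
    [IsSimpleModule A N] : N = Submodule.fst A S S' ∨ N = Submodule.snd A S S' := by
  have : IsSimpleModule A (Submodule.fst A S S') := .congr (Submodule.fstEquiv A S S')
  have : IsSimpleModule A (Submodule.snd A S S') := .congr (Submodule.sndEquiv A S S')
  have hN : IsAtom N := IsSimpleModule.isAtom
  rcases ((LinearMap.snd A S S').comp N.subtype).bijective_or_eq_zero with hsnd | hsnd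
  · rcases ((LinearMap.fst A S S').comp N.subtype).bijective_or_eq_zero with hfst | hfst
    · exact hne.elim ((LinearEquiv.ofBijective _ hfst).symm.trans (LinearEquiv.ofBijective _ hsnd))
    · have hle : N ≤ Submodule.snd A S S' := fun x hx => LinearMap.congr_fun hfst ⟨x, hx⟩
      exact .inr ((IsSimpleModule.isAtom.le_iff_eq hN.ne_bot).1 hle)
  · have hle : N ≤ Submodule.fst A S S' := fun x hx => LinearMap.congr_fun hsnd ⟨x, hx⟩
    exact .inl ((IsSimpleModule.isAtom.le_iff_eq hN.ne_bot).1 hle)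

theorem nonempty_linearEquiv_iff_eq_fst (hne : IsEmpty (S ≃ₗ[A] S'))
    (N : Submodule A (S × S')) : Nonempty (N ≃ₗ[A] S) ↔ N = Submodule.fst A S S' := by
  refine ⟨fun ⟨e⟩ => ?_, fun h => ⟨h ▸ Submodule.fstEquiv A S S'⟩⟩
  have : IsSimpleModule A N := .congr e
  refine (eq_fst_or_eq_snd_of_isSimpleModule hne N).resolve_right ?_
  rintro rfl
  exact hne.elim (e.symm.trans (Submodule.sndEquiv A S S'))

theorem nonempty_linearEquiv_iff_eq_snd (hne : IsEmpty (S ≃ₗ[A] S'))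
    (N : Submodule A (S × S')) : Nonempty (N ≃ₗ[A] S') ↔ N = Submodule.snd A S S' := by
  refine ⟨fun ⟨e⟩ => ?_, fun h => ⟨h ▸ Submodule.sndEquiv A S S'⟩⟩
  have : IsSimpleModule A N := .congr e
  refine (eq_fst_or_eq_snd_of_isSimpleModule hne N).resolve_left ?_
  rintro rfl
  exact hne.elim ((Submodule.fstEquiv A S S').symm.trans e)

end SimpleProduct

namespace Supermodule

variable {A : Type v} [Ring A] [Algebra ℂ A] {𝒜 : ZMod 2 → Submodule ℂ A} [GradedAlgebra 𝒜]

section ParityTwist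

variable {V : Supermodule.{u} 𝒜} {S S' : Type*} [AddCommGroup S] [Module A S] [AddCommGroup S']
  [Module A S']

/-- The homomorphism obtained from `f` by precomposing with a parity-semilinear map and composing
with the parity operator of `V`; the two twists cancel. -/
def parityTwist (f : S' →ₗ[A] V.carrier) (φ : S →ₛₗ[parityAut 𝒜] S') : S →ₗ[A] V.carrier :=
  V.parity.comp (f.comp φ)

theorem parityTwist_apply (f : S' →ₗ[A] V.carrier) (φ : S →ₛₗ[parityAut 𝒜] S') (x : S) :
    parityTwist f φ x = V.parity (f (φ x)) := rfl

theorem parityTwist_ne_zero {f : S' →ₗ[A] V.carrier} (hf : f ≠ 0) (φ : S ≃ₛₗ[parityAut 𝒜] S') :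
    parityTwist f φ.toLinearMap ≠ 0 := by
  contrapose! hf
  ext y
  have h := LinearMap.congr_fun hf (φ.symm y)
  exact V.parity_involutive.injective (by simpa [parityTwist_apply] using h)

end ParityTwist

section TypeQ

variable {S S' : Type w} [AddCommGroup S] [Module A S] [AddCommGroup S'] [Module A S']
  (φ : S ≃ₛₗ[parityAut 𝒜] S')

/-- The involution `(x, y) ↦ (φ⁻¹ y, φ x)` of `S × S'`. -/
def swapInvolution : S × S' →ₛₗ[parityAut 𝒜] S × S' where
  toFun z := (φ.symm z.2, φ z.1)
  map_add' := by simp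
  map_smul' a z := Prod.ext (map_smulₛₗ φ.symm a z.2) (map_smulₛₗ φ a z.1)

theorem swapInvolution_involutive : Function.Involutive (swapInvolution φ) := fun z => by
  simp [swapInvolution]

variable [Module ℂ S] [IsScalarTower ℂ A S] [Module ℂ S'] [IsScalarTower ℂ A S']

/-- The supermodule on `S × S'` with even part `{(x, φ x)}` and odd part `{(x, -φ x)}`. -/
abbrev typeQ : Supermodule.{w} 𝒜 :=
  ofInvolution (swapInvolution φ) (swapInvolution_involutive φ)

theorem parity_typeQ (x : S) (y : S') : (typeQ φ).parity (x, y) = (φ.symm y, φ x) :=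
  parity_ofInvolution _ _ (x, y)

theorem mem_grade_zero_typeQ (z : S × S') :
    z ∈ (typeQ φ).grade 0 ↔ ∃ x, z = (x, φ x) := by
  obtain ⟨x, y⟩ := z
  rw [mem_grade_iff, parity_typeQ]
  simp only [ZMod.val_zero, pow_zero, one_smul, Prod.mk.injEq, exists_eq_left']
  exact ⟨fun h => h.2.symm, fun h => ⟨by simp [h], h.symm⟩⟩

theorem mem_grade_one_typeQ (z : S × S') :
    z ∈ (typeQ φ).grade 1 ↔ ∃ x, z = (x, -φ x) := by
  obtain ⟨x, y⟩ := z
  rw [mem_grade_iff, parity_typeQ]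
  simp only [ZMod.val_one, pow_one, neg_one_smul, Prod.neg_mk, Prod.mk.injEq, exists_eq_left']
  exact ⟨fun h => by rw [h.2, neg_neg], fun h => by simp [h]⟩

theorem swaps_graphs_iff (J : S × S' →ₗ[ℂ] S × S') :
    (∀ x, J (x, φ x) = (x, -φ x) ∧ J (x, -φ x) = (x, φ x)) ↔
      J = LinearMap.prodMap LinearMap.id (-LinearMap.id) := by
  refine ⟨fun hJ => LinearMap.ext fun z => ?_, fun hJ x => by simp [hJ]⟩
  obtain ⟨a, ha, b, hb, rfl⟩ := (typeQ φ).exists_homogeneous_add z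
  obtain ⟨x, rfl⟩ := (mem_grade_zero_typeQ φ a).1 ha
  obtain ⟨y, rfl⟩ := (mem_grade_one_typeQ φ b).1 hb
  rw [map_add, map_add, (hJ x).1, (hJ y).2]
  simp

theorem isOddInvolution_typeQ :
    (typeQ φ).IsOddInvolution (LinearMap.prodMap LinearMap.id (-LinearMap.id)) := by
  refine ⟨fun i z hz => ?_, fun z => by simp⟩
  rcases zmod_two_eq_zero_or_one i with rfl | rfl
  · obtain ⟨x, rfl⟩ := (mem_grade_zero_typeQ φ z).1 hz
    exact (mem_grade_one_typeQ φ _).2 ⟨x, by simp⟩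
  · obtain ⟨x, rfl⟩ := (mem_grade_one_typeQ φ z).1 hz
    exact (mem_grade_zero_typeQ φ _).2 ⟨x, by simp⟩

variable [IsSimpleModule A S] [IsSimpleModule A S']

theorem isSimple_typeQ (hne : IsEmpty (S ≃ₗ[A] S')) : (typeQ φ).IsSimple := by
  have := IsSimpleModule.nontrivial A S
  have : IsSemisimpleModule A (S × S') := isSemisimpleModule_prod
  refine ⟨inferInstanceAs (Nontrivial (S × S')), fun N hN => ?_⟩
  rw [isSubsupermodule_iff] at hN
  refine (IsSemisimpleModule.eq_bot_or_exists_simple_le N).imp_right fun ⟨m, hmN, hm⟩ => ?_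
  have fst_le_iff : Submodule.fst A S S' ≤ N ↔ Submodule.snd A S S' ≤ N := by
    constructor
    · rintro h ⟨x, y⟩ (rfl : x = 0)
      have hy : (typeQ φ).parity (φ.symm y, 0) ∈ N := hN _ (h rfl)
      rwa [parity_typeQ, map_zero, φ.apply_symm_apply] at hy
    · rintro h ⟨x, y⟩ (rfl : y = 0)
      have hx : (typeQ φ).parity (0, φ x) ∈ N := hN _ (h rfl)
      rwa [parity_typeQ, map_zero, φ.symm_apply_apply] at hx
  rw [eq_top_iff, ← Submodule.fst_sup_snd, sup_le_iff]
  rcases eq_fst_or_eq_snd_of_isSimpleModule hne m with rfl | rfl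
  · exact ⟨hmN, fst_le_iff.1 hmN⟩
  · exact ⟨fst_le_iff.2 hmN, hmN⟩

theorem isSimpleTypeQ_typeQ (hne : IsEmpty (S ≃ₗ[A] S')) : (typeQ φ).IsSimpleTypeQ :=
  ⟨isSimple_typeQ φ hne, not_isSimpleModule_prod (A := A) (S := S) (S' := S')⟩

theorem IsSimple.homogeneouslyIsomorphic_typeQ {V : Supermodule.{u} 𝒜} (hV : V.IsSimple)
    (hne : IsEmpty (S ≃ₗ[A] S')) {f : S →ₗ[A] V.carrier} (hf : f ≠ 0) :
    V.HomogeneouslyIsomorphic (typeQ φ) := by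
  let g : S × S' →ₗ[A] V.carrier := f.coprod (parityTwist f φ.symm.toLinearMap)
  have hg : g ≠ 0 := fun h => hf (LinearMap.ext fun x => by
    simpa [g] using LinearMap.congr_fun h (x, 0))
  refine hV.homogeneouslyIsomorphic (isSimple_typeQ φ hne) 0 g hg fun ⟨x, y⟩ => ?_
  rw [parity_typeQ]
  simp [g, parityTwist_apply, V.parity_involutive _, add_comm]

end TypeQ

section TypeM

variable {S : Type w} [AddCommGroup S] [Module ℂ S] [Module A S] [IsScalarTower ℂ A S]
  [IsSimpleModule A S] (δ : S →ₛₗ[parityAut 𝒜] S) (hδ : Function.Involutive δ)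

theorem isSimpleTypeM_ofInvolution : (ofInvolution δ hδ).IsSimpleTypeM :=
  ⟨⟨IsSimpleModule.nontrivial A S, fun N _ => eq_bot_or_eq_top N⟩, ‹IsSimpleModule A S›⟩

theorem IsSimple.homogeneouslyIsomorphic_ofInvolution {V : Supermodule.{u} 𝒜} (hV : V.IsSimple)
    {f : S →ₗ[A] V.carrier} (hf : f ≠ 0) : V.HomogeneouslyIsomorphic (ofInvolution δ hδ) := by
  have hW := (isSimpleTypeM_ofInvolution δ hδ).1
  by_cases h : f + parityTwist f δ = 0
  · refine hV.homogeneouslyIsomorphic hW 1 f hf fun x => ?_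
    have hx : f (δ x) + V.parity (f x) = 0 := by
      simpa [parityTwist_apply, hδ x] using LinearMap.congr_fun h (δ x)
    rw [parity_ofInvolution, ZMod.val_one, pow_one, neg_one_smul]
    exact eq_neg_of_add_eq_zero_right hx
  · refine hV.homogeneouslyIsomorphic hW 0 (f + parityTwist f δ) h fun x => ?_
    rw [parity_ofInvolution]
    simp [parityTwist_apply, V.parity_involutive _, hδ x, add_comm]

end TypeM

end Supermodule

/-! ### Polytabloids -/

section LabelAntisymmetrizer

variable (k : Type*) [Ring k] {α β : Type*} [Fintype α] [DecidableEq α] [DecidableEq β] (c : α → β)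

/-- The permutations that preserve the labelling `c`. The column stabilizer of a tableau is the
case in which each letter is labelled by its column. -/
def labelStabilizer : Finset (Perm α) := Finset.univ.filter fun π => ∀ a, c (π a) = c a

variable {c} in
@[simp]
theorem mem_labelStabilizer {π : Perm α} : π ∈ labelStabilizer c ↔ ∀ a, c (π a) = c a :=
  Finset.mem_filter_univ π

theorem card_labelStabilizer_ne_zero : (labelStabilizer c).card ≠ 0 :=
  Finset.card_ne_zero_of_mem (a := 1) (by simp)

/-- The signed sum `∑ sgn(π) π` over the permutations that preserve the labelling `c`. -/
def labelAntisymmetrizer : MonoidAlgebra k (Perm α) :=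
  ∑ π ∈ labelStabilizer c, MonoidAlgebra.single π ((Perm.sign π : ℤ) : k)

theorem labelAntisymmetrizer_eq_sum :
    labelAntisymmetrizer k c =
      ∑ π ∈ labelStabilizer c, Perm.sign π • MonoidAlgebra.of k _ π := by
  refine Finset.sum_congr rfl fun π _ => ?_
  rw [Units.smul_def, MonoidAlgebra.of_apply, MonoidAlgebra.smul_single, zsmul_one]

theorem labelAntisymmetrizer_smul {M : Type*} [AddCommGroup M] [Module (MonoidAlgebra k (Perm α)) M]
    (x : M) : labelAntisymmetrizer k c • x =
      ∑ π ∈ labelStabilizer c, Perm.sign π • MonoidAlgebra.of k _ π • x := by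
  simp only [labelAntisymmetrizer_eq_sum, Finset.sum_smul, smul_assoc]

variable {c} in
theorem labelAntisymmetrizer_mul_of {σ : Perm α} (hσ : ∀ a, c (σ a) = c a) :
    labelAntisymmetrizer k c * MonoidAlgebra.of k _ σ = Perm.sign σ • labelAntisymmetrizer k c := by
  rw [labelAntisymmetrizer_eq_sum, Finset.sum_mul, Finset.smul_sum]
  refine Finset.sum_equiv (Equiv.mulRight σ) (fun π => ?_) fun π _ => ?_
  · simp only [mem_labelStabilizer, Equiv.coe_mulRight, Perm.mul_apply]
    rw [← σ.forall_congr_right (q := fun a => c (π a) = c a)]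
    simp only [hσ]
  · rw [Equiv.coe_mulRight, smul_mul_assoc, ← map_mul, smul_smul, Perm.sign_mul, mul_left_comm,
      Int.units_mul_self, mul_one]

theorem of_mul_labelAntisymmetrizer (σ : Perm α) :
    MonoidAlgebra.of k _ σ * labelAntisymmetrizer k c =
      labelAntisymmetrizer k (c ∘ ⇑σ⁻¹) * MonoidAlgebra.of k _ σ := by
  rw [labelAntisymmetrizer_eq_sum, labelAntisymmetrizer_eq_sum, Finset.sum_mul, Finset.mul_sum]
  refine Finset.sum_equiv (MulAut.conj σ).toEquiv (fun π => ?_) fun π _ => ?_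
  · simp only [mem_labelStabilizer, MulEquiv.toEquiv_eq_coe, EquivLike.coe_coe,
      MulAut.conj_apply, Function.comp_apply, Perm.mul_apply, Perm.inv_def, σ.symm_apply_apply]
    exact (σ.symm.forall_congr_right (q := fun a => c (π a) = c a)).symm
  · simp only [MulEquiv.toEquiv_eq_coe, EquivLike.coe_coe, MulAut.conj_apply, mul_smul_comm,
      smul_mul_assoc, ← map_mul (MonoidAlgebra.of k (Perm α)), inv_mul_cancel_right]
    rw [Perm.sign_mul, Perm.sign_mul, Perm.sign_inv, mul_right_comm, Int.units_mul_self, one_mul]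

theorem labelAntisymmetrizer_mul_self :
    labelAntisymmetrizer k c * labelAntisymmetrizer k c =
      (labelStabilizer c).card • labelAntisymmetrizer k c := by
  nth_rewrite 2 [labelAntisymmetrizer_eq_sum]
  rw [Finset.mul_sum, ← Finset.sum_const]
  refine Finset.sum_congr rfl fun π hπ => ?_
  rw [mul_smul_comm, labelAntisymmetrizer_mul_of k (mem_labelStabilizer.1 hπ), smul_smul,
    Int.units_mul_self, one_smul]

variable {c} in
theorem labelAntisymmetrizer_smul_eq_zero {M : Type*} [AddCommGroup M] [IsAddTorsionFree M]
    [Module (MonoidAlgebra k (Perm α)) M] {x : M} {a b : α} (hab : a ≠ b) (hc : c a = c b)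
    (hx : MonoidAlgebra.of k _ (Equiv.swap a b) • x = x) : labelAntisymmetrizer k c • x = 0 := by
  have hswap (d : α) : c (Equiv.swap a b d) = c d := by
    rw [Equiv.swap_apply_def]
    split_ifs with h h' <;> simp [*]
  rw [← self_eq_neg]
  conv_lhs => rw [← hx, smul_smul, labelAntisymmetrizer_mul_of k hswap, Perm.sign_swap hab]
  simp

end LabelAntisymmetrizer

section TabloidModule

variable {n : ℕ}

theorem RowAssignment.smul_apply (σ : Perm (Fin n)) (f : RowAssignment n) (k : Fin n) :
    (σ • f) k = f (σ⁻¹ k) := rfl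

theorem RowAssignment.smul_eq_self_iff {σ : Perm (Fin n)} {f : RowAssignment n} :
    σ • f = f ↔ ∀ k, f (σ k) = f k := by
  refine funext_iff.trans ?_
  rw [← σ.forall_congr_right]
  simp [smul_apply, eq_comm]

variable (n) in
/-- The basis of the permutation module given by the row assignments, i.e. by the tabloids of all
shapes. -/
def tabloidBasis : Module.Basis (RowAssignment n) ℂ (TabloidModule n) :=
  .ofRepr ((Representation.asModuleEquiv _).trans (MonoidAlgebra.coeffLinearEquiv ℂ))

theorem tabloidBasis_apply (f : RowAssignment n) :
    tabloidBasis n f = (Representation.asModuleEquiv _).symm (MonoidAlgebra.single f (1 : ℂ)) :=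
  rfl

theorem of_smul_tabloidBasis (σ : Perm (Fin n)) (f : RowAssignment n) :
    MonoidAlgebra.of ℂ _ σ • tabloidBasis n f = tabloidBasis n (σ • f) := by
  rw [tabloidBasis_apply, ← Representation.asModuleEquiv_symm_map_rho,
    Representation.ofMulAction_single, tabloidBasis_apply]

theorem injective_of_labelAntisymmetrizer_smul_ne_zero {c : Fin n → ℕ} {f : RowAssignment n}
    (h : labelAntisymmetrizer ℂ c • tabloidBasis n f ≠ 0) :
    Function.Injective fun k => (c k, f k) := by
  have : IsAddTorsionFree (TabloidModule n) := .of_isTorsionFree ℂ _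
  contrapose! h
  obtain ⟨a, b, hcf, hab⟩ := Function.not_injective_iff.1 h
  obtain ⟨hc, hf⟩ := Prod.mk.inj hcf
  refine labelAntisymmetrizer_smul_eq_zero ℂ hab hc ?_
  rw [of_smul_tabloidBasis, RowAssignment.smul_eq_self_iff.2]
  intro k
  rw [Equiv.swap_apply_def]
  split_ifs with h h' <;> simp [*]

end TabloidModule

namespace Tableau

variable {n : ℕ} {μ : Ptn n}

theorem nonempty (μ : Ptn n) : Nonempty (Tableau μ) :=
  ⟨Fintype.equivOfCardEq (by simpa using μ.2.symm)⟩

/-- The row of each letter of a tableau. -/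
def row (T : Tableau μ) : Fin n → ℕ := fun k => (T k).1.1

/-- The column of each letter of a tableau. -/
def col (T : Tableau μ) : Fin n → ℕ := fun k => (T k).1.2

/-- The rows of a tableau, as an index of `tabloidBasis`: this is the tabloid of the tableau. -/
def rowAssignment (T : Tableau μ) : RowAssignment n := T.row

theorem row_symm (T : Tableau μ) (c : μ.1.cells) : T.row (T.symm c) = c.1.1 := by simp [row]

theorem col_symm (T : Tableau μ) (c : μ.1.cells) : T.col (T.symm c) = c.1.2 := by simp [col]

theorem row_lt_colLen_col (T : Tableau μ) (k : Fin n) : T.row k < μ.1.colLen (T.col k) :=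
  YoungDiagram.mem_iff_lt_colLen.1 ((YoungDiagram.mem_cells _).1 (T k).2)

theorem injective_col_row (T : Tableau μ) : Function.Injective fun k => (T.col k, T.row k) :=
  fun _ _ h => T.injective (Subtype.ext (Prod.ext (congrArg Prod.snd h) (congrArg Prod.fst h)))

theorem polytabloid_eq (T : Tableau μ) :
    T.polytabloid = labelAntisymmetrizer ℂ T.col • tabloidBasis n T.rowAssignment := by
  have h : T.columnAntisymmetrizer = labelAntisymmetrizer ℂ T.col :=
    Finset.sum_congr (by unfold labelStabilizer; congr!) fun _ _ => rfl
  rw [polytabloid, h]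
  rfl

theorem polytabloid_trans (T : Tableau μ) (σ : Perm (Fin n)) :
    polytabloid (μ := μ) (σ⁻¹.trans T) = MonoidAlgebra.of ℂ _ σ • T.polytabloid := by
  rw [polytabloid_eq, polytabloid_eq, smul_smul, of_mul_labelAntisymmetrizer, mul_smul,
    of_smul_tabloidBasis]
  rfl

theorem repr_polytabloid_rowAssignment (T : Tableau μ) :
    (tabloidBasis n).repr T.polytabloid T.rowAssignment = 1 := by
  simp only [polytabloid_eq, labelAntisymmetrizer_smul, of_smul_tabloidBasis, map_sum,
    Finsupp.finsetSum_apply]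
  refine (Finset.sum_eq_single_of_mem (1 : Perm (Fin n)) (by simp) fun π hπ h1 => ?_).trans
    (by simp)
  have hrow : π • T.rowAssignment ≠ T.rowAssignment := fun h => h1 <| Equiv.ext fun k =>
    T.injective_col_row
      (Prod.ext (mem_labelStabilizer.1 hπ k) (RowAssignment.smul_eq_self_iff.1 h k))
  rw [Units.smul_def, map_zsmul, Module.Basis.repr_self, Finsupp.smul_apply,
    Finsupp.single_eq_of_ne' hrow, smul_zero]

theorem polytabloid_ne_zero (T : Tableau μ) : T.polytabloid ≠ 0 := by
  intro h
  simpa [h] using T.repr_polytabloid_rowAssignment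

theorem polytabloid_mem_specht (T : Tableau μ) : T.polytabloid ∈ specht μ :=
  Submodule.subset_span ⟨T, rfl⟩

theorem specht_eq_span_singleton (T : Tableau μ) :
    specht μ = Submodule.span (GroupAlgSn n) {T.polytabloid} := by
  refine le_antisymm (Submodule.span_le.2 ?_) (Submodule.span_mono (by simp))
  rintro _ ⟨T', rfl⟩
  have h := T.polytabloid_trans (T.trans T'.symm)
  rw [show (T.trans T'.symm : Perm (Fin n))⁻¹.trans T = T' by ext1; simp [Perm.inv_def]] at h
  rw [h]
  exact Submodule.smul_mem _ _ (Submodule.mem_span_singleton_self _)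

theorem labelAntisymmetrizer_smul_polytabloid_ne_zero (T : Tableau μ) :
    labelAntisymmetrizer ℂ T.col • T.polytabloid ≠ 0 := by
  have : IsAddTorsionFree (TabloidModule n) := .of_isTorsionFree ℂ _
  rw [polytabloid_eq, smul_smul, labelAntisymmetrizer_mul_self, smul_assoc, ← polytabloid_eq]
  exact smul_ne_zero (card_labelStabilizer_ne_zero T.col) T.polytabloid_ne_zero

end Tableau

theorem smul_mem_of_mem_span {k A M : Type*} [CommSemiring k] [Semiring A] [Algebra k A]
    [AddCommMonoid M] [Module k M] [Module A M] [IsScalarTower k A M] {a : A} {s : Set M}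
    {N : Submodule k M} (hs : ∀ x ∈ s, a • x ∈ N) {x : M} (hx : x ∈ Submodule.span k s) :
    a • x ∈ N :=
  (Submodule.span_le (p := N.comap (Algebra.lsmul k k M a))).2 hs hx

theorem mem_span_of_mem_span_monoidAlgebra {k G M : Type*} [CommSemiring k] [Monoid G]
    [AddCommMonoid M] [Module k M] [Module (MonoidAlgebra k G) M]
    [IsScalarTower k (MonoidAlgebra k G) M] {s : Set M}
    (hs : ∀ g, ∀ x ∈ s, MonoidAlgebra.of k G g • x ∈ s) {x : M}
    (hx : x ∈ Submodule.span (MonoidAlgebra k G) s) : x ∈ Submodule.span k s := by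
  let N := MonoidAlgebra.submoduleOfSMulMem (Submodule.span k s) fun g x hx =>
    smul_mem_of_mem_span (fun y hy => Submodule.subset_span (hs g y hy)) hx
  exact (Submodule.span_le (p := N)).2 Submodule.subset_span hx

theorem mem_span_tabloids_of_mem_specht {n : ℕ} {μ : Ptn n} {x : TabloidModule n}
    (hx : x ∈ specht μ) :
    x ∈ Submodule.span ℂ (Set.range fun T : Tableau μ => tabloidBasis n T.rowAssignment) := by
  refine mem_span_of_mem_span_monoidAlgebra (G := Perm (Fin n)) ?_ (Submodule.span_le.2 ?_ hx)
  · rintro σ _ ⟨T, rfl⟩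
    exact ⟨σ⁻¹.trans T, (of_smul_tabloidBasis σ T.rowAssignment).symm⟩
  · rintro _ ⟨T, rfl⟩
    exact Submodule.smul_mem _ _ (Submodule.subset_span ⟨T, rfl⟩)

/-! ### Simplicity of the Specht modules -/

section Dominance

theorem eq_of_sum_rowLen_eq {μ ν : YoungDiagram}
    (h : ∀ r, ∑ i ∈ Finset.range r, μ.rowLen i = ∑ i ∈ Finset.range r, ν.rowLen i) : μ = ν := by
  have hrow (i : ℕ) : μ.rowLen i = ν.rowLen i := by
    simpa [Finset.sum_range_succ, h i] using h (i + 1)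
  ext ⟨i, j⟩
  rw [YoungDiagram.mem_cells, YoungDiagram.mem_cells, YoungDiagram.mem_iff_lt_rowLen,
    YoungDiagram.mem_iff_lt_rowLen, hrow]

namespace Tableau

variable {n : ℕ} {μ ν : Ptn n}

theorem card_row_eq (T : Tableau μ) (i : ℕ) :
    (Finset.univ.filter fun k => T.row k = i).card = μ.1.rowLen i := by
  rw [YoungDiagram.rowLen_eq_card]
  refine Finset.card_nbij (fun k => (T k).1) ?_ (fun a _ b _ h => T.injective (Subtype.ext h)) ?_
  · intro k hk
    exact YoungDiagram.mem_row_iff.2 ⟨(YoungDiagram.mem_cells _).1 (T k).2,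
      (Finset.mem_filter_univ k).1 hk⟩
  · intro c hc
    obtain ⟨hmem, rfl⟩ := YoungDiagram.mem_row_iff.1 hc
    exact ⟨T.symm ⟨c, (YoungDiagram.mem_cells _).2 hmem⟩, by simp [row_symm], by simp⟩

theorem card_row_lt (T : Tableau μ) (r : ℕ) :
    (Finset.univ.filter fun k => T.row k < r).card = ∑ i ∈ Finset.range r, μ.1.rowLen i := by
  rw [Finset.card_eq_sum_card_fiberwise (f := T.row) (t := Finset.range r) (by simp [Set.MapsTo])]
  refine Finset.sum_congr rfl fun i hi => ?_
  rw [← T.card_row_eq, Finset.filter_filter]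
  congr 1
  ext k
  simp only [Finset.mem_filter_univ, and_iff_right_iff_imp]
  rintro rfl
  exact Finset.mem_range.1 hi

theorem card_col_eq_and_row_lt (T : Tableau μ) (j r : ℕ) :
    (Finset.univ.filter fun k => T.col k = j ∧ T.row k < r).card = min r (μ.1.colLen j) := by
  rw [← Finset.card_range (min r _)]
  refine Finset.card_nbij T.row ?_ ?_ ?_
  · intro k hk
    obtain ⟨rfl, hlt⟩ := (Finset.mem_filter_univ k).1 hk
    simp [hlt, T.row_lt_colLen_col]
  · intro a ha b hb h
    simp only [Finset.coe_filter_univ, Set.mem_ofPred_eq] at ha hb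
    exact T.injective_col_row (Prod.ext (ha.1.trans hb.1.symm) h)
  · intro i hi
    obtain ⟨hir, hic⟩ : i < r ∧ i < μ.1.colLen j := by simpa using hi
    have hmem : (i, j) ∈ μ.1.cells :=
      (YoungDiagram.mem_cells _).2 (YoungDiagram.mem_iff_lt_colLen.2 hic)
    exact ⟨T.symm ⟨(i, j), hmem⟩, by simp [row_symm, col_symm, hir], by simp [row_symm]⟩

theorem card_col_eq (T : Tableau μ) (j : ℕ) :
    (Finset.univ.filter fun k => T.col k = j).card = μ.1.colLen j := by
  rw [← min_self (μ.1.colLen j), ← T.card_col_eq_and_row_lt j]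
  exact congrArg Finset.card <| Finset.filter_congr fun k _ =>
    ⟨fun h => ⟨h, h ▸ T.row_lt_colLen_col k⟩, And.left⟩

theorem card_eq_sum_card_col (T : Tableau μ) (p : Fin n → Prop) [DecidablePred p] :
    (Finset.univ.filter p).card =
      ∑ j ∈ Finset.univ.image T.col, (Finset.univ.filter fun k => T.col k = j ∧ p k).card := by
  rw [Finset.card_eq_sum_card_fiberwise (f := T.col) (t := Finset.univ.image T.col)
    (by simp [Set.MapsTo])]
  simp only [Finset.filter_filter, and_comm]

section ColumnInjective

variable (T : Tableau μ) {f : Fin n → ℕ} (hf : Function.Injective fun k => (T.col k, f k))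
include hf

theorem card_col_eq_and_lt_le (j r : ℕ) :
    (Finset.univ.filter fun k => T.col k = j ∧ f k < r).card ≤ min r (μ.1.colLen j) := by
  refine le_min ?_ ?_
  · rw [← Finset.card_range r]
    refine Finset.card_le_card_of_injOn f (fun k hk => by simp_all) fun a ha b hb h => ?_
    simp only [Finset.coe_filter_univ, Set.mem_ofPred_eq] at ha hb
    exact hf (Prod.ext (ha.1.trans hb.1.symm) h)
  · rw [← T.card_col_eq]
    exact Finset.card_le_card (Finset.monotone_filter_right _ fun k _ hk => hk.1)

theorem card_lt_le (r : ℕ) :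
    (Finset.univ.filter fun k => f k < r).card ≤ ∑ i ∈ Finset.range r, μ.1.rowLen i := by
  rw [← T.card_row_lt, T.card_eq_sum_card_col, T.card_eq_sum_card_col fun k => T.row k < r]
  simp only [card_col_eq_and_row_lt]
  exact Finset.sum_le_sum fun j _ => T.card_col_eq_and_lt_le hf j r

theorem lt_colLen_col_of_card_lt_eq
    (hcard : ∀ r, (Finset.univ.filter fun k => f k < r).card =
      ∑ i ∈ Finset.range r, μ.1.rowLen i) (k : Fin n) : f k < μ.1.colLen (T.col k) := by
  set r := μ.1.colLen (T.col k)
  have hsum := hcard r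
  rw [← T.card_row_lt, T.card_eq_sum_card_col, T.card_eq_sum_card_col fun k => T.row k < r] at hsum
  simp only [card_col_eq_and_row_lt] at hsum
  have hcol := (Finset.sum_eq_sum_iff_of_le fun j _ => T.card_col_eq_and_lt_le hf j r).1 hsum
    (T.col k) (by simp)
  rw [min_self] at hcol
  have hfilter := Finset.eq_of_subset_of_card_le
    (Finset.monotone_filter_right Finset.univ
      (p := fun l => T.col l = T.col k ∧ f l < r) fun l _ hl => hl.1)
    ((T.card_col_eq _).trans hcol.symm).le
  have hk : k ∈ Finset.univ.filter fun l => T.col l = T.col k := by simp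
  rw [← hfilter] at hk
  exact ((Finset.mem_filter_univ k).1 hk).2

/-- Having rows of the same lengths as `T`, the assignment `f` must fill each column of `T`
exactly. -/
theorem exists_perm_col_eq_and_row_eq
    (hcard : ∀ r, (Finset.univ.filter fun k => f k < r).card =
      ∑ i ∈ Finset.range r, μ.1.rowLen i) :
    ∃ π : Perm (Fin n), (∀ k, T.col (π k) = T.col k) ∧ ∀ k, T.row (π k) = f k := by
  let g (k : Fin n) : Fin n := T.symm ⟨(f k, T.col k), (YoungDiagram.mem_cells _).2
    (YoungDiagram.mem_iff_lt_colLen.2 (T.lt_colLen_col_of_card_lt_eq hf hcard k))⟩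
  have hrow (k : Fin n) : T.row (g k) = f k := T.row_symm _
  have hcol (k : Fin n) : T.col (g k) = T.col k := T.col_symm _
  have hg : Function.Injective g := fun a b hab => hf <| Prod.ext
    ((hcol a).symm.trans (hab ▸ hcol b)) ((hrow a).symm.trans (hab ▸ hrow b))
  exact ⟨Equiv.ofBijective g (Finite.injective_iff_bijective.1 hg), hcol, hrow⟩

end ColumnInjective

theorem labelAntisymmetrizer_smul_mem_span (T : Tableau μ) {x : TabloidModule n}
    (hx : x ∈ specht μ) :
    labelAntisymmetrizer ℂ T.col • x ∈ Submodule.span ℂ {T.polytabloid} := by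
  refine smul_mem_of_mem_span ?_ (mem_span_tabloids_of_mem_specht hx)
  rintro _ ⟨T', rfl⟩
  beta_reduce
  by_cases h : labelAntisymmetrizer ℂ T.col • tabloidBasis n T'.rowAssignment = 0
  · rw [h]
    exact zero_mem _
  · obtain ⟨π, hπ, hrow⟩ := T.exists_perm_col_eq_and_row_eq
      (injective_of_labelAntisymmetrizer_smul_ne_zero h) T'.card_row_lt
    have hrow' : T'.rowAssignment = π⁻¹ • T.rowAssignment := by
      funext k
      rw [RowAssignment.smul_apply, inv_inv]
      exact (hrow k).symm
    have hπ' (k : Fin n) : T.col (π⁻¹ k) = T.col k := by simpa using (hπ (π⁻¹ k)).symm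
    rw [hrow', ← of_smul_tabloidBasis, smul_smul, labelAntisymmetrizer_mul_of ℂ hπ', smul_assoc,
      ← polytabloid_eq, Units.smul_def]
    exact zsmul_mem (Submodule.mem_span_singleton_self _) _

theorem sum_rowLen_le_of_smul_ne_zero (T : Tableau μ) {x : TabloidModule n} (hx : x ∈ specht ν)
    (h : labelAntisymmetrizer ℂ T.col • x ≠ 0) (r : ℕ) :
    ∑ i ∈ Finset.range r, ν.1.rowLen i ≤ ∑ i ∈ Finset.range r, μ.1.rowLen i := by
  contrapose! h
  refine (Submodule.mem_bot ℂ).1 (smul_mem_of_mem_span ?_ (mem_span_tabloids_of_mem_specht hx))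
  rintro _ ⟨T', rfl⟩
  rw [Submodule.mem_bot]
  contrapose! h
  rw [← T'.card_row_lt]
  exact T.card_lt_le (injective_of_labelAntisymmetrizer_smul_ne_zero h) r

end Tableau

end Dominance

/-- The projections of `e` to a submodule and to a complement cannot both be killed by `κ`, so one
of the two contains a nonzero multiple of `e`. -/
theorem isSimpleModule_of_cyclic {k A V : Type*} [Field k] [Ring A] [Algebra k A] [AddCommGroup V]
    [Module k V] [Module A V] [IsScalarTower k A V] [IsSemisimpleModule A V] {e : V}
    (hgen : Submodule.span A {e} = ⊤) {κ : A} (hκ : ∀ x : V, κ • x ∈ Submodule.span k {e})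
    (hκe : κ • e ≠ 0) : IsSimpleModule A V := by
  have eq_top_of_smul_ne_zero (N : Submodule A V) {x : V} (hx : x ∈ N) (h : κ • x ≠ 0) :
      N = ⊤ := by
    obtain ⟨c, hc⟩ := Submodule.mem_span_singleton.1 (hκ x)
    have hc0 : c ≠ 0 := by
      rintro rfl
      exact h (by rw [← hc, zero_smul])
    have hce : c • e ∈ N := hc ▸ N.smul_mem κ hx
    rw [eq_top_iff, ← hgen, Submodule.span_singleton_le_iff_mem]
    exact ((N.restrictScalars k).smul_mem_iff hc0).1 hce
  have : Nontrivial V := ⟨e, 0, fun h => hκe (by rw [h, smul_zero])⟩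
  rw [isSimpleModule_iff]
  refine ⟨fun N => ?_⟩
  obtain ⟨N', hN'⟩ := exists_isCompl N
  obtain ⟨x, hx, y, hy, rfl⟩ := Submodule.mem_sup.1 (hN'.sup_eq_top ▸ Submodule.mem_top (x := e))
  by_cases hκx : κ • x = 0
  · rw [smul_add, hκx, zero_add] at hκe
    exact .inl (eq_bot_of_isCompl_top (eq_top_of_smul_ne_zero N' hy hκe ▸ hN'))
  · exact .inr (eq_top_of_smul_ne_zero N hx hκx)

section Specht

variable {n : ℕ}

instance specht_isSimpleModule (μ : Ptn n) : IsSimpleModule (GroupAlgSn n) (specht μ) := by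
  obtain ⟨T⟩ := Tableau.nonempty μ
  refine isSimpleModule_of_cyclic (k := ℂ) (e := ⟨T.polytabloid, T.polytabloid_mem_specht⟩)
    (κ := labelAntisymmetrizer ℂ T.col) ?_ (fun x => ?_) ?_
  · refine (Submodule.eq_top_iff').2 fun x => ?_
    obtain ⟨a, ha⟩ := Submodule.mem_span_singleton.1 (T.specht_eq_span_singleton.le x.2)
    exact Submodule.mem_span_singleton.2 ⟨a, Subtype.ext ha⟩
  · obtain ⟨c, hc⟩ := Submodule.mem_span_singleton.1 (T.labelAntisymmetrizer_smul_mem_span x.2)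
    exact Submodule.mem_span_singleton.2 ⟨c, Subtype.ext hc⟩
  · exact fun h => T.labelAntisymmetrizer_smul_polytabloid_ne_zero (congrArg Subtype.val h)

theorem sum_rowLen_le_of_specht_equiv {μ ν : Ptn n}
    (e : specht μ ≃ₗ[GroupAlgSn n] specht ν) (r : ℕ) :
    ∑ i ∈ Finset.range r, ν.1.rowLen i ≤ ∑ i ∈ Finset.range r, μ.1.rowLen i := by
  obtain ⟨T⟩ := Tableau.nonempty μ
  let p : specht μ := ⟨T.polytabloid, T.polytabloid_mem_specht⟩
  refine T.sum_rowLen_le_of_smul_ne_zero (e p).2 ?_ r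
  rw [← Submodule.coe_smul, ← map_smul, Ne, Submodule.coe_eq_zero, e.map_eq_zero_iff]
  exact fun h => T.labelAntisymmetrizer_smul_polytabloid_ne_zero (congrArg Subtype.val h)

theorem eq_of_nonempty_specht_equiv {μ ν : Ptn n}
    (h : Nonempty (specht μ ≃ₗ[GroupAlgSn n] specht ν)) : μ = ν :=
  h.elim fun e => Subtype.ext <| eq_of_sum_rowLen_eq fun r =>
    le_antisymm (sum_rowLen_le_of_specht_equiv e.symm r) (sum_rowLen_le_of_specht_equiv e r)

end Specht

/-! ### Associators -/

section SignSemilinear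

variable {n : ℕ}

theorem parityAut_of (σ : Perm (Fin n)) :
    parityAut (snGrading n) (MonoidAlgebra.of ℂ _ σ) =
      Perm.sign σ • MonoidAlgebra.of ℂ _ σ := by
  rw [parityAut_of_mem (𝒜 := snGrading n) (i := permParity σ)
    (show _ ∈ snGrading n _ from Submodule.subset_span ⟨σ, rfl, rfl⟩)]
  rcases Int.units_eq_one_or (Perm.sign σ) with h | h <;> simp [permParity, h, ZMod.val_one]

variable {V W : Type*} [AddCommGroup V] [Module ℂ V] [Module (GroupAlgSn n) V]
  [IsScalarTower ℂ (GroupAlgSn n) V] [AddCommGroup W] [Module ℂ W] [Module (GroupAlgSn n) W]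
  [IsScalarTower ℂ (GroupAlgSn n) W]

/-- A `ℂ`-linear map that commutes with permutations up to their signs, as a parity-semilinear
map. -/
def semilinearOfSign (f : V →ₗ[ℂ] W)
    (hf : ∀ (σ : Perm (Fin n)) (x : V), f (MonoidAlgebra.of ℂ _ σ • x) =
      Perm.sign σ • MonoidAlgebra.of ℂ _ σ • f x) : V →ₛₗ[parityAut (snGrading n)] W where
  toFun := f
  map_add' := map_add f
  map_smul' a x := by
    induction a using MonoidAlgebra.induction_on with
    | of σ => rw [hf, parityAut_of, smul_assoc]
    | add a b ha hb => simp only [add_smul, map_add, ha, hb]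
    | smul c a ha =>
      rw [smul_assoc, map_smul, ha, ← smul_assoc, Algebra.smul_def, Algebra.smul_def, map_mul,
        parityAut_algebraMap]

@[simp]
theorem semilinearOfSign_apply (f : V →ₗ[ℂ] W)
    (hf : ∀ (σ : Perm (Fin n)) (x : V), f (MonoidAlgebra.of ℂ _ σ • x) =
      Perm.sign σ • MonoidAlgebra.of ℂ _ σ • f x) (x : V) : semilinearOfSign f hf x = f x := rfl

end SignSemilinear

theorem Ptn.conj_conj {n : ℕ} (μ : Ptn n) : μ.conj.conj = μ :=
  Subtype.ext (YoungDiagram.transpose_transpose μ.1)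

theorem repr_of_smul {n : ℕ} (σ : Perm (Fin n)) (x : TabloidModule n) (f : RowAssignment n) :
    (tabloidBasis n).repr (MonoidAlgebra.of ℂ _ σ • x) f =
      (tabloidBasis n).repr x (σ⁻¹ • f) := by
  let g : TabloidModule n →ₗ[ℂ] ℂ := (tabloidBasis n).coord f ∘ₗ Algebra.lsmul ℂ ℂ _
    (MonoidAlgebra.of ℂ _ σ)
  suffices g = (tabloidBasis n).coord (σ⁻¹ • f) from LinearMap.congr_fun this x
  refine (tabloidBasis n).ext fun h => ?_
  classical
  simp only [g, LinearMap.comp_apply, Algebra.lsmul_coe, of_smul_tabloidBasis,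
    Module.Basis.coord_apply, Module.Basis.repr_self, Finsupp.single_apply, eq_inv_smul_iff]

namespace Tableau

variable {n : ℕ} {μ : Ptn n}

/-- The transposed tableau. -/
def transpose (T : Tableau μ) : Tableau μ.conj :=
  T.trans ((Equiv.prodComm ℕ ℕ).subtypeEquiv fun c => by
    rw [YoungDiagram.mem_cells, YoungDiagram.mem_cells]
    exact (YoungDiagram.mem_transpose (μ := μ.1) (c := c.swap)).symm)

/-- The parity-semilinear map sending the tabloid of `T` to the polytabloid of its transpose and
killing the tabloids of the other shapes. -/
def associator (T : Tableau μ) :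
    TabloidModule n →ₛₗ[parityAut (snGrading n)] TabloidModule n :=
  semilinearOfSign (∑ σ : Perm (Fin n), ((tabloidBasis n).coord (σ • T.rowAssignment)).smulRight
      (Perm.sign σ • tabloidBasis n (σ • T.transpose.rowAssignment))) fun τ x => by
    simp only [LinearMap.sum_apply, LinearMap.smulRight_apply, Module.Basis.coord_apply,
      repr_of_smul, Finset.smul_sum]
    rw [← Equiv.sum_comp (Equiv.mulLeft τ)]
    refine Finset.sum_congr rfl fun σ _ => ?_
    rw [Equiv.coe_mulLeft, mul_smul, inv_smul_smul, mul_smul, ← of_smul_tabloidBasis τ,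
      Perm.sign_mul, mul_smul, smul_comm (MonoidAlgebra.of ℂ _ τ),
      smul_comm (MonoidAlgebra.of ℂ _ τ), smul_comm (Perm.sign τ) ((tabloidBasis n).repr x _)]

theorem associator_apply (T : Tableau μ) (x : TabloidModule n) :
    T.associator x = ∑ σ : Perm (Fin n), (tabloidBasis n).repr x (σ • T.rowAssignment) •
      Perm.sign σ • tabloidBasis n (σ • T.transpose.rowAssignment) := by
  simp [associator]

theorem associator_tabloidBasis (T : Tableau μ) :
    T.associator (tabloidBasis n T.rowAssignment) = T.transpose.polytabloid := by
  rw [polytabloid_eq, labelAntisymmetrizer_smul, associator_apply, Module.Basis.repr_self,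
    ← Finset.sum_subset (Finset.subset_univ (labelStabilizer T.transpose.col)) fun σ _ hσ => ?_]
  · refine Finset.sum_congr rfl fun σ hσ => ?_
    have hrow : σ • T.rowAssignment = T.rowAssignment :=
      RowAssignment.smul_eq_self_iff.2 (mem_labelStabilizer.1 hσ)
    rw [hrow, Finsupp.single_eq_same, one_smul, of_smul_tabloidBasis]
  · have hrow : σ • T.rowAssignment ≠ T.rowAssignment := fun h =>
      hσ (mem_labelStabilizer.2 (RowAssignment.smul_eq_self_iff.1 h))
    rw [Finsupp.single_eq_of_ne hrow, zero_smul]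

theorem associator_polytabloid (T : Tableau μ) :
    T.associator T.polytabloid = ∑ π ∈ labelStabilizer T.col,
      MonoidAlgebra.of ℂ _ π • T.transpose.polytabloid := by
  rw [polytabloid_eq, labelAntisymmetrizer_smul, map_sum]
  refine Finset.sum_congr rfl fun π _ => ?_
  rw [Units.smul_def, map_zsmul, map_smulₛₗ, parityAut_of, associator_tabloidBasis, smul_assoc,
    ← Units.smul_def, smul_smul, Int.units_mul_self, one_smul]

theorem associator_polytabloid_ne_zero (T : Tableau μ) : T.associator T.polytabloid ≠ 0 := by
  intro h
  have hcoeff : (tabloidBasis n).repr (T.associator T.polytabloid) T.transpose.rowAssignment =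
      (labelStabilizer T.col).card := by
    rw [associator_polytabloid, map_sum, Finsupp.finsetSum_apply, Finset.cast_card]
    refine Finset.sum_congr rfl fun π hπ => ?_
    have hrow : π⁻¹ • T.transpose.rowAssignment = T.transpose.rowAssignment :=
      inv_smul_eq_iff.2 (RowAssignment.smul_eq_self_iff.2 (mem_labelStabilizer.1 hπ)).symm
    rw [repr_of_smul, hrow, repr_polytabloid_rowAssignment]
  rw [h, map_zero, Finsupp.zero_apply, eq_comm, Nat.cast_eq_zero] at hcoeff
  exact card_labelStabilizer_ne_zero T.col hcoeff

theorem associator_mem_specht (T : Tableau μ) {x : TabloidModule n} (hx : x ∈ specht μ) :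
    T.associator x ∈ specht μ.conj := by
  obtain ⟨a, rfl⟩ := Submodule.mem_span_singleton.1 (T.specht_eq_span_singleton.le hx)
  rw [map_smulₛₗ, associator_polytabloid]
  exact Submodule.smul_mem _ _ <| Submodule.sum_mem _ fun π _ =>
    Submodule.smul_mem _ _ T.transpose.polytabloid_mem_specht

end Tableau

section AssociatorFamily

variable {n : ℕ}

theorem exists_injective_semilinear_specht (μ : Ptn n) :
    ∃ ψ : specht μ →ₛₗ[parityAut (snGrading n)] specht μ.conj, Function.Injective ψ := by
  obtain ⟨T⟩ := Tableau.nonempty μ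
  let ψ : specht μ →ₛₗ[parityAut (snGrading n)] specht μ.conj :=
    (T.associator.domRestrict (specht μ)).codRestrict (specht μ.conj)
      fun x => T.associator_mem_specht x.2
  have hker : LinearMap.ker ψ ≠ ⊤ := fun h => T.associator_polytabloid_ne_zero <|
    congrArg Subtype.val (LinearMap.congr_fun (LinearMap.ker_eq_top.1 h)
      ⟨T.polytabloid, T.polytabloid_mem_specht⟩)
  exact ⟨ψ, LinearMap.ker_eq_bot.1 ((eq_bot_or_eq_top (LinearMap.ker ψ)).resolve_right hker)⟩

instance specht_finite (μ : Ptn n) : Module.Finite ℂ (specht μ) :=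
  Module.Finite.trans (GroupAlgSn n) (specht μ)

/-- The identification of the Specht modules of equal partitions, which avoids rewriting their
types. -/
def spechtCongr {μ ν : Ptn n} (h : μ = ν) : specht μ ≃ₗ[GroupAlgSn n] specht ν :=
  LinearEquiv.ofEq _ _ (by rw [h])

theorem coe_apply_spechtCongr {F : Ptn n → Ptn n} (ψ : ∀ μ, specht μ → specht (F μ)) {μ ν : Ptn n}
    (h : μ = ν) (x : specht μ) : (ψ ν (spechtCongr h x) : TabloidModule n) = ψ μ x := by
  subst h
  rfl

theorem exists_coe_comp_eq_smul {μ : Ptn n}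
    (ψ : specht μ →ₛₗ[parityAut (snGrading n)] specht μ.conj)
    (ψ' : specht μ.conj →ₛₗ[parityAut (snGrading n)] specht μ.conj.conj) :
    ∃ c : ℂ, ∀ x, (ψ' (ψ x) : TabloidModule n) = c • (x : TabloidModule n) := by
  obtain ⟨c, hc⟩ := (IsSimpleModule.algebraMap_end_bijective_of_isAlgClosed ℂ).2
    ((spechtCongr μ.conj_conj).toLinearMap.comp (ψ'.comp ψ : specht μ →ₗ[GroupAlgSn n] _))
  exact ⟨c, fun x => (congrArg Subtype.val (LinearMap.congr_fun hc x)).symm⟩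

section Scalars

variable {ψ : ∀ μ : Ptn n, specht μ →ₛₗ[parityAut (snGrading n)] specht μ.conj}
  (hψ : ∀ μ, Function.Injective (ψ μ)) {c : Ptn n → ℂ}
  (hc : ∀ μ x, (ψ μ.conj (ψ μ x) : TabloidModule n) = c μ • (x : TabloidModule n))
include hψ hc

theorem scalar_ne_zero (μ : Ptn n) : c μ ≠ 0 := by
  intro h
  have := IsSimpleModule.nontrivial (GroupAlgSn n) (specht μ)
  obtain ⟨x, hx⟩ := exists_ne (0 : specht μ)
  have hcx := hc μ x
  rw [h, zero_smul, Submodule.coe_eq_zero, map_eq_zero_iff _ (hψ _),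
    map_eq_zero_iff _ (hψ _)] at hcx
  exact hx hcx

theorem scalar_conj (μ : Ptn n) : c μ.conj = c μ := by
  have := IsSimpleModule.nontrivial (GroupAlgSn n) (specht μ)
  obtain ⟨x, hx⟩ := exists_ne (0 : specht μ)
  have hcx : spechtCongr μ.conj_conj (ψ μ.conj (ψ μ x)) = c μ • x := Subtype.ext (hc μ x)
  have hconj := hc μ.conj (ψ μ x)
  rw [← coe_apply_spechtCongr (fun μ => ψ μ) μ.conj_conj, hcx, ← complexLinear_apply, map_smul]
    at hconj
  exact (smul_left_injective ℂ (Subtype.coe_ne_coe.2 <| (map_ne_zero_iff _ (hψ μ)).2 hx) hconj).symm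

end Scalars

theorem exists_isAssociatorFamily (n : ℕ) :
    ∃ φ : ∀ μ : Ptn n, specht μ →ₗ[ℂ] specht μ.conj, IsAssociatorFamily φ := by
  choose ψ hψ using exists_injective_semilinear_specht (n := n)
  choose c hc using fun μ => exists_coe_comp_eq_smul (ψ μ) (ψ μ.conj)
  choose s hs using fun z : ℂ => IsAlgClosed.exists_pow_nat_eq z two_pos
  refine ⟨fun μ => (s (c μ))⁻¹ • complexLinear (ψ μ), fun μ σ x => ?_, fun μ x => ?_⟩
  · simp only [LinearMap.smul_apply, complexLinear_apply, map_smulₛₗ, parityAut_of, smul_assoc,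
      Int.cast_smul_eq_zsmul, ← Units.smul_def]
    rw [smul_comm (s _)⁻¹, smul_comm (s _)⁻¹]
  · rw [LinearMap.smul_apply, LinearMap.smul_apply, map_smul, scalar_conj hψ hc, smul_smul,
      complexLinear_apply, complexLinear_apply, Submodule.coe_smul_of_tower, hc, smul_smul,
      ← mul_inv, ← sq, hs, inv_mul_cancel₀ (scalar_ne_zero hψ hc μ), one_smul]

end AssociatorFamily

/-! ### The simple modules of the symmetric group -/

section Characters

open Representation

variable {G k : Type*} [Group G] [Field k]

section Modules

variable {V W : Type*} [AddCommGroup V] [Module k V] [Module (MonoidAlgebra k G) V]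
  [IsScalarTower k (MonoidAlgebra k G) V] [AddCommGroup W] [Module k W]
  [Module (MonoidAlgebra k G) W] [IsScalarTower k (MonoidAlgebra k G) W]

theorem isIrreducible_ofModule' [IsSimpleModule (MonoidAlgebra k G) V] :
    IsIrreducible (ofModule' V : Representation k G V) := by
  let ρ : Representation k G V := ofModule' V
  let e : ρ.asModule →ₗ[MonoidAlgebra k G] V :=
    MonoidAlgebra.equivariantOfLinearOfComm ρ.asModuleEquiv.toLinearMap fun g x =>
      (asModuleEquiv_map_smul _ _ _).trans (by rw [asAlgebraHom_single_one]; rfl)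
  rw [irreducible_iff_isSimpleModule_asModule]
  exact IsSimpleModule.congr (.ofBijective e ρ.asModuleEquiv.bijective)

theorem nonempty_linearEquiv_of_ofModule'
    (h : Nonempty ((ofModule' V : Representation k G V).Equiv (ofModule' W))) :
    Nonempty (V ≃ₗ[MonoidAlgebra k G] W) := by
  obtain ⟨e⟩ := h
  let f : V →ₗ[MonoidAlgebra k G] W :=
    MonoidAlgebra.equivariantOfLinearOfComm e.toLinearEquiv.toLinearMap fun g x =>
      LinearMap.congr_fun (e.toIntertwiningMap.isIntertwining' g) x
  exact ⟨.ofBijective f e.toLinearEquiv.bijective⟩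

end Modules

/-- The character of a representation, as a function of the conjugacy class. -/
def classCharacter {V : Type*} [AddCommGroup V] [Module k V] (ρ : Representation k G V) :
    ConjClasses G → k :=
  Quotient.lift ρ.character fun g h hgh => by
    obtain ⟨c, rfl⟩ := isConj_iff.1 hgh
    exact (ρ.char_conj g c).symm

variable (G k) in
/-- The pairing of class functions for which irreducible characters are orthonormal. -/
def classPairing [Fintype G] : LinearMap.BilinForm k (ConjClasses G → k) :=
  LinearMap.mk₂ k
    (fun χ ψ => (Nat.card G : k)⁻¹ * ∑ g : G, χ (ConjClasses.mk g) * ψ (ConjClasses.mk g⁻¹))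
    (fun _ _ _ => by simp only [Pi.add_apply, add_mul, Finset.sum_add_distrib, mul_add])
    (fun _ _ _ => by
      simp only [Pi.smul_apply, smul_eq_mul, mul_assoc, ← Finset.mul_sum, mul_left_comm])
    (fun _ _ _ => by simp only [Pi.add_apply, Finset.sum_add_distrib, mul_add])
    (fun _ _ _ => by
      simp only [Pi.smul_apply, smul_eq_mul, ← Finset.mul_sum, mul_left_comm])

variable [IsAlgClosed k] [Invertible (Nat.card G : k)]

open scoped Classical in
theorem classPairing_classCharacter [Fintype G] {V W : Type*} [AddCommGroup V] [Module k V]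
    [FiniteDimensional k V] [AddCommGroup W] [Module k W] [FiniteDimensional k W]
    (ρ : Representation k G V) (σ : Representation k G W) [IsIrreducible ρ] [IsIrreducible σ] :
    classPairing G k (classCharacter ρ) (classCharacter σ) =
      if Nonempty (σ.Equiv ρ) then 1 else 0 :=
  char_orthonormal ρ σ

theorem exists_equiv_of_card_conjClasses_le [Finite G] {ι : Type*} [Finite ι]
    (hι : Nat.card (ConjClasses G) ≤ Nat.card ι) {V : ι → Type*} [∀ i, AddCommGroup (V i)]
    [∀ i, Module k (V i)] [∀ i, FiniteDimensional k (V i)] (ρ : ∀ i, Representation k G (V i))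
    [∀ i, IsIrreducible (ρ i)] (hρ : Pairwise fun i j => IsEmpty ((ρ i).Equiv (ρ j)))
    {W : Type*} [AddCommGroup W] [Module k W] [FiniteDimensional k W]
    (σ : Representation k G W) [IsIrreducible σ] : ∃ i, Nonempty ((ρ i).Equiv σ) := by
  have := Fintype.ofFinite G
  have := Fintype.ofFinite ι
  have := Fintype.ofFinite (ConjClasses G)
  have hli : LinearIndependent k fun i => classCharacter (ρ i) := by
    refine LinearMap.linearIndependent_of_isOrthoᵢ (B := classPairing G k)
      (LinearMap.isOrthoᵢ_def.2 fun i j hij => ?_) fun i => ?_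
    · rw [classPairing_classCharacter, if_neg (not_nonempty_iff.2 (hρ hij.symm))]
    · rw [classPairing_classCharacter, if_pos ⟨.refl _⟩]
      exact one_ne_zero
  have hspan : Submodule.span k (Set.range fun i => classCharacter (ρ i)) = ⊤ := by
    refine hli.span_eq_top_of_card_eq_finrank' (le_antisymm hli.fintype_card_le_finrank ?_)
    simpa [Module.finrank_fintype_fun_eq_card, Nat.card_eq_fintype_card] using hι
  by_contra! hσ
  have hzero : classPairing G k (classCharacter σ) = 0 :=
    LinearMap.ext_on_range hspan fun i => by
      rw [classPairing_classCharacter, if_neg (not_nonempty_iff.2 (hσ i)), LinearMap.zero_apply]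
  have hone := classPairing_classCharacter σ σ
  rw [hzero, LinearMap.zero_apply, if_pos ⟨.refl _⟩] at hone
  exact zero_ne_one hone

end Characters

theorem card_cellsOfRowLens (w : List ℕ) : (YoungDiagram.cellsOfRowLens w).card = w.sum := by
  induction w with
  | nil => rfl
  | cons a w ih =>
    rw [YoungDiagram.cellsOfRowLens, Finset.card_union_of_disjoint, Finset.card_map, ih]
    · simp
    · refine Finset.disjoint_left.2 fun c hc hc' => ?_
      obtain ⟨d, -, rfl⟩ := Finset.mem_map.1 hc'
      exact Nat.succ_ne_zero d.1 (Finset.mem_singleton.1 (Finset.mem_product.1 hc).1)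

/-- The Young diagram whose row lengths are the parts of a partition. The equation between the
indices is there because `Equiv.Perm.partition` takes values in the partitions of a cardinality. -/
def Ptn.ofPartition {m n : ℕ} (h : m = n) (p : m.Partition) : Ptn n :=
  ⟨.ofRowLens (p.parts.sort (· ≥ ·)) (Multiset.pairwise_sort _ _).sortedGE, by
    refine (card_cellsOfRowLens _).trans ?_
    rw [← Multiset.sum_coe, Multiset.sort_eq, p.parts_sum, h]⟩

theorem Ptn.rowLens_ofPartition {m n : ℕ} (h : m = n) (p : m.Partition) :
    (ofPartition h p).1.rowLens = p.parts.sort (· ≥ ·) :=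
  YoungDiagram.rowLens_ofRowLens_eq_self (hw := (Multiset.pairwise_sort _ _).sortedGE)
    fun _ hx => p.parts_pos ((Multiset.mem_sort _).1 hx)

theorem Ptn.ofPartition_injective {m n : ℕ} (h : m = n) :
    Function.Injective (ofPartition h) := by
  intro p q hpq
  refine Nat.Partition.ext ?_
  rw [← Multiset.sort_eq p.parts (· ≥ ·), ← rowLens_ofPartition h, hpq, rowLens_ofPartition,
    Multiset.sort_eq]

section Classification

variable {n : ℕ}

/-- The partition of `n` given by the cycle type, fixed points included, of a conjugacy class. -/
def Ptn.ofConjClass : ConjClasses (Perm (Fin n)) → Ptn n :=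
  Quotient.lift (fun σ => ofPartition (Fintype.card_fin n) σ.partition) fun _ _ h =>
    congrArg _ (Perm.partition_eq_of_isConj.1 h)

theorem Ptn.ofConjClass_injective : Function.Injective (ofConjClass (n := n)) := by
  rintro ⟨σ⟩ ⟨τ⟩ h
  exact Quotient.sound <| Perm.partition_eq_of_isConj.2 <|
    ofPartition_injective (Fintype.card_fin n) h

theorem exists_specht_equiv (V : Type*) [AddCommGroup V] [Module ℂ V] [Module (GroupAlgSn n) V]
    [IsScalarTower ℂ (GroupAlgSn n) V] [IsSimpleModule (GroupAlgSn n) V] :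
    ∃ μ : Ptn n, Nonempty (specht μ ≃ₗ[GroupAlgSn n] V) := by
  have : Module.Finite ℂ V := Module.Finite.trans (GroupAlgSn n) V
  have : Invertible (Nat.card (Perm (Fin n)) : ℂ) := invertibleOfNonzero (by simp)
  have : Representation.IsIrreducible (.ofModule' V : Representation ℂ (Perm (Fin n)) V) :=
    isIrreducible_ofModule'
  have (c : ConjClasses (Perm (Fin n))) : Representation.IsIrreducible
      (.ofModule' (specht (Ptn.ofConjClass c)) : Representation ℂ (Perm (Fin n)) _) :=
    isIrreducible_ofModule'
  obtain ⟨c, hc⟩ := exists_equiv_of_card_conjClasses_le le_rfl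
    (fun c => (.ofModule' (specht (Ptn.ofConjClass c)) : Representation ℂ (Perm (Fin n)) _))
    (fun c d hcd => not_nonempty_iff.1 fun h => hcd <| Ptn.ofConjClass_injective <|
      eq_of_nonempty_specht_equiv (nonempty_linearEquiv_of_ofModule' h))
    (.ofModule' V : Representation ℂ (Perm (Fin n)) V)
  exact ⟨_, nonempty_linearEquiv_of_ofModule' hc⟩

end Classification

/-! ### The simple supermodules -/

section SpechtSupermodule

variable {n : ℕ}

theorem IsConjRepresentatives.eq {R : Set (Ptn n)} (hR : IsConjRepresentatives R) {μ ν : Ptn n}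
    (hμ : μ ∈ R) (hν : ν ∈ R) (h : μ = ν ∨ μ = ν.conj) : μ = ν :=
  (hR ν).unique ⟨hμ, h⟩ ⟨hν, .inl rfl⟩

theorem isEmpty_specht_equiv_conj {μ : Ptn n} (h : μ ≠ μ.conj) :
    IsEmpty (specht μ ≃ₗ[GroupAlgSn n] specht μ.conj) :=
  not_nonempty_iff.1 (mt eq_of_nonempty_specht_equiv h)

namespace IsAssociatorFamily

variable {φ : ∀ μ : Ptn n, specht μ →ₗ[ℂ] specht μ.conj} (hφ : IsAssociatorFamily φ)

/-- The associator `φ μ` as a parity-semilinear map. -/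
def semilinear (μ : Ptn n) : specht μ →ₛₗ[parityAut (snGrading n)] specht μ.conj :=
  semilinearOfSign (φ μ) fun σ x => by
    rw [hφ.1, Int.cast_smul_eq_zsmul, ← Units.smul_def]

/-- The associator `φ μ` as a parity-semilinear equivalence. -/
def equiv (μ : Ptn n) : specht μ ≃ₛₗ[parityAut (snGrading n)] specht μ.conj where
  __ := hφ.semilinear μ
  invFun y := spechtCongr μ.conj_conj (φ μ.conj y)
  left_inv x := Subtype.ext (hφ.2 μ x)
  right_inv y := Subtype.ext <|
    (coe_apply_spechtCongr (fun μ => φ μ) μ.conj_conj (φ μ.conj y)).trans (hφ.2 μ.conj y)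

/-- The associator of a self-conjugate partition, as a parity-semilinear endomorphism. -/
def selfAssociator {μ : Ptn n} (h : μ = μ.conj) :
    specht μ →ₛₗ[parityAut (snGrading n)] specht μ :=
  (spechtCongr h.symm).toLinearMap.comp (hφ.semilinear μ)

theorem selfAssociator_involutive {μ : Ptn n} (h : μ = μ.conj) :
    Function.Involutive (hφ.selfAssociator h) := fun x =>
  Subtype.ext <| (coe_apply_spechtCongr (fun μ => φ μ) h.symm (φ μ x)).trans (hφ.2 μ x)

theorem mem_grade_ofInvolution_selfAssociator {μ : Ptn n} (h : μ = μ.conj) {i : ZMod 2} {ε : ℂ}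
    (hε : (-1) ^ i.val = ε) (x : specht μ) :
    x ∈ (Supermodule.ofInvolution _ (hφ.selfAssociator_involutive h)).grade i ↔
      x ∈ spechtEigen (φ μ) ε :=
  hε ▸ Subtype.ext_iff

open scoped Classical in
/-- The simple supermodule `W^μ`, on `S^μ` if `μ = μ'` and on `S^μ ⊕ S^{μ'}` otherwise. -/
def supermodule (μ : Ptn n) : Supermodule.{0} (snGrading n) :=
  if h : μ = μ.conj then
    .ofInvolution (hφ.selfAssociator h) (hφ.selfAssociator_involutive h)
  else .typeQ (hφ.equiv μ)

theorem supermodule_of_eq {μ : Ptn n} (h : μ = μ.conj) :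
    hφ.supermodule μ =
      .ofInvolution (hφ.selfAssociator h) (hφ.selfAssociator_involutive h) :=
  dif_pos h

theorem supermodule_of_ne {μ : Ptn n} (h : μ ≠ μ.conj) :
    hφ.supermodule μ = .typeQ (hφ.equiv μ) :=
  dif_neg h

theorem exists_hom_supermodule_ne_zero (μ : Ptn n) :
    ∃ f : specht μ →ₗ[GroupAlgSn n] (hφ.supermodule μ).carrier, f ≠ 0 := by
  have := IsSimpleModule.nontrivial (GroupAlgSn n) (specht μ)
  by_cases h : μ = μ.conj
  · rw [supermodule_of_eq hφ h]
    exact exists_ne (0 : specht μ →ₗ[GroupAlgSn n] specht μ)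
  · rw [supermodule_of_ne hφ h]
    exact ⟨LinearMap.inl _ _ _, LinearMap.ne_zero_of_injective LinearMap.inl_injective⟩

theorem eq_or_eq_conj_of_hom_ne_zero {κ μ : Ptn n}
    {f : specht κ →ₗ[GroupAlgSn n] (hφ.supermodule μ).carrier} (hf : f ≠ 0) :
    κ = μ ∨ κ = μ.conj := by
  by_cases h : μ = μ.conj
  · revert f
    rw [supermodule_of_eq hφ h]
    intro f hf
    exact .inl <| eq_of_nonempty_specht_equiv
      ⟨.ofBijective f (LinearMap.bijective_of_ne_zero hf)⟩
  · revert f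
    rw [supermodule_of_ne hφ h]
    intro f hf
    exact (nonempty_linearEquiv_of_hom_prod hf).imp eq_of_nonempty_specht_equiv
      eq_of_nonempty_specht_equiv

theorem eq_or_eq_conj_of_homogeneouslyIsomorphic {μ ν : Ptn n}
    (h : (hφ.supermodule μ).HomogeneouslyIsomorphic (hφ.supermodule ν)) :
    μ = ν ∨ μ = ν.conj := by
  obtain ⟨e⟩ := h.nonempty_linearEquiv
  obtain ⟨f, hf⟩ := hφ.exists_hom_supermodule_ne_zero μ
  exact hφ.eq_or_eq_conj_of_hom_ne_zero (f := e.toLinearMap.comp f) fun h => hf <|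
    LinearMap.ext fun x => e.map_eq_zero_iff.1 (LinearMap.congr_fun h x)

theorem homogeneouslyIsomorphic_supermodule {V : Supermodule.{u} (snGrading n)}
    (hV : V.IsSimple) {μ : Ptn n} {f : specht μ →ₗ[GroupAlgSn n] V.carrier} (hf : f ≠ 0) :
    V.HomogeneouslyIsomorphic (hφ.supermodule μ) := by
  by_cases h : μ = μ.conj
  · rw [supermodule_of_eq hφ h]
    exact hV.homogeneouslyIsomorphic_ofInvolution _ _ hf
  · rw [supermodule_of_ne hφ h]
    exact hV.homogeneouslyIsomorphic_typeQ _ (isEmpty_specht_equiv_conj h) hf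

end IsAssociatorFamily

theorem exists_hom_specht_ne_zero (V : Type*) [AddCommGroup V] [Module ℂ V]
    [Module (GroupAlgSn n) V] [IsScalarTower ℂ (GroupAlgSn n) V] [Nontrivial V] :
    ∃ (κ : Ptn n) (f : specht κ →ₗ[GroupAlgSn n] V), f ≠ 0 := by
  obtain ⟨N, hN⟩ := IsSemisimpleModule.exists_simple_submodule (GroupAlgSn n) V
  obtain ⟨κ, ⟨e⟩⟩ := exists_specht_equiv (n := n) N
  have := IsSimpleModule.nontrivial (GroupAlgSn n) (specht κ)
  exact ⟨κ, _, LinearMap.ne_zero_of_injective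
    (f := N.subtype.comp e.toLinearMap) (N.injective_subtype.comp e.injective)⟩

theorem IsAssociatorFamily.exists_homogeneouslyIsomorphic_supermodule
    {φ : ∀ μ : Ptn n, specht μ →ₗ[ℂ] specht μ.conj} (hφ : IsAssociatorFamily φ)
    {R : Set (Ptn n)} (hR : IsConjRepresentatives R) {V : Supermodule.{u} (snGrading n)}
    (hV : V.IsSimple) : ∃ μ ∈ R, V.HomogeneouslyIsomorphic (hφ.supermodule μ) := by
  have := hV.1
  obtain ⟨κ, f, hf⟩ := exists_hom_specht_ne_zero (n := n) V.carrier
  obtain ⟨μ, ⟨hμ, rfl | rfl⟩, -⟩ := hR κ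
  · exact ⟨μ, hμ, hφ.homogeneouslyIsomorphic_supermodule hV hf⟩
  · exact ⟨κ.conj, hμ, hφ.homogeneouslyIsomorphic_supermodule hV <|
      Supermodule.parityTwist_ne_zero hf (hφ.equiv κ).symm⟩

end SpechtSupermodule

end

theorem mainTheorem4 (n : ℕ) (hn : 1 < n) :
    (∃ φ : ∀ μ : Ptn n, specht μ →ₗ[ℂ] specht μ.conj, IsAssociatorFamily φ) ∧
    ∀ φ : ∀ μ : Ptn n, specht μ →ₗ[ℂ] specht μ.conj, IsAssociatorFamily φ →
    ∀ R : Set (Ptn n), IsConjRepresentatives R →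
    ∃ W : R → Supermodule.{0} (snGrading n),
      (∀ μ : R, μ.1 ≠ μ.1.conj →
        (W μ).IsSimpleTypeQ ∧
        ∃ e : (W μ).carrier ≃ₗ[GroupAlgSn n] (specht μ.1 × specht μ.1.conj),
          (∀ w, w ∈ (W μ).grade 0 ↔ ∃ x : specht μ.1, e w = (x, φ μ.1 x)) ∧
          (∀ w, w ∈ (W μ).grade 1 ↔ ∃ x : specht μ.1, e w = (x, -φ μ.1 x)) ∧
          -- the decomposition is canonical: the two summands are the only submodules of their
          -- isomorphism types
          (∀ N : Submodule (GroupAlgSn n) (W μ).carrier,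
            Nonempty (N ≃ₗ[GroupAlgSn n] specht μ.1) ↔ ∀ w, w ∈ N ↔ (e w).2 = 0) ∧
          (∀ N : Submodule (GroupAlgSn n) (W μ).carrier,
            Nonempty (N ≃ₗ[GroupAlgSn n] specht μ.1.conj) ↔ ∀ w, w ∈ N ↔ (e w).1 = 0) ∧
          (∃! J : (W μ).carrier →ₗ[ℂ] (W μ).carrier, ∀ x : specht μ.1,
            J (e.symm (x, φ μ.1 x)) = e.symm (x, -φ μ.1 x) ∧
            J (e.symm (x, -φ μ.1 x)) = e.symm (x, φ μ.1 x)) ∧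
          (∀ J : (W μ).carrier →ₗ[ℂ] (W μ).carrier, (∀ x : specht μ.1,
            J (e.symm (x, φ μ.1 x)) = e.symm (x, -φ μ.1 x) ∧
            J (e.symm (x, -φ μ.1 x)) = e.symm (x, φ μ.1 x)) → (W μ).IsOddInvolution J)) ∧
      (∀ μ : R, μ.1 = μ.1.conj →
        (W μ).IsSimpleTypeM ∧
        ∃ e : (W μ).carrier ≃ₗ[GroupAlgSn n] specht μ.1,
          (∀ w, w ∈ (W μ).grade 0 ↔ e w ∈ spechtEigen (φ μ.1) 1) ∧
          (∀ w, w ∈ (W μ).grade 1 ↔ e w ∈ spechtEigen (φ μ.1) (-1))) ∧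
      (∀ μ ν : R, (W μ).HomogeneouslyIsomorphic (W ν) → μ = ν) ∧
      (∀ V : Supermodule.{u} (snGrading n), V.IsSimple →
        ∃ μ : R, V.HomogeneouslyIsomorphic (W μ)) := by
  refine ⟨exists_isAssociatorFamily n, fun φ hφ R hR => ⟨fun μ => hφ.supermodule μ.1,
    fun μ hμ => ?_, fun μ hμ => ?_, fun μ ν h => ?_, fun V hV => ?_⟩⟩
  · beta_reduce
    rw [hφ.supermodule_of_ne hμ]
    have hne := isEmpty_specht_equiv_conj hμ
    have hJ := Supermodule.swaps_graphs_iff (S := specht μ.1) (S' := specht μ.1.conj) (hφ.equiv μ.1)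
    exact ⟨Supermodule.isSimpleTypeQ_typeQ _ hne, .refl _ _, Supermodule.mem_grade_zero_typeQ _,
      Supermodule.mem_grade_one_typeQ _,
      fun N => (nonempty_linearEquiv_iff_eq_fst hne N).trans SetLike.ext_iff,
      fun N => (nonempty_linearEquiv_iff_eq_snd hne N).trans SetLike.ext_iff,
      ⟨_, (hJ _).2 rfl, fun J => (hJ J).1⟩,
      fun J h => (hJ J).1 h ▸ Supermodule.isOddInvolution_typeQ _⟩
  · beta_reduce
    rw [hφ.supermodule_of_eq hμ]
    exact ⟨Supermodule.isSimpleTypeM_ofInvolution _ _, .refl _ _,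
      hφ.mem_grade_ofInvolution_selfAssociator hμ (pow_zero _),
      hφ.mem_grade_ofInvolution_selfAssociator hμ (pow_one _)⟩
  · exact Subtype.ext (hR.eq μ.2 ν.2 (hφ.eq_or_eq_conj_of_homogeneouslyIsomorphic h))
  · obtain ⟨μ, hμ, h⟩ := hφ.exists_homogeneouslyIsomorphic_supermodule hR hV
    exact ⟨⟨μ, hμ⟩, h⟩
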